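/- **Theorem.** Let $A=(A_0,A_1,A_2,A_3)\in\mathbb C^4$ and let $Z(A)$ be the differential equation $p_0f''''+p_1f'''+p_2f''+p_3f'+p_4f=0$ in $x$, where $$\begin{aligned} p_0&=x^3(x-1)^2,\qquad p_1=-2x^2(x-1)(2A_0x-2A_0-5x+3),\\ p_2&=x\big\{(6A_0^2-A_2^2-A_3^2-24A_0+25)x^2+(-11A_0^2-A_1^2+A_2^2+A_3^2+36A_0-\tfrac{59}2)x+\tfrac14(10A_0-9)(2A_0-3)\big\},\\ p_3&=-(2A_0-3)(2A_0^2-A_2^2-A_3^2-6A_0+5)x^2+(A_0-1)(6A_0^2+2A_1^2-2A_2^2-2A_3^2-16A_0+11)x-\tfrac14(2A_0-3)(2A_0-1)^2,\\ p_4&=\big((A_0-1)^2-A_3^2\big)\big((A_0-1)^2-A_2^2\big)x-\tfrac14(2A_0-1)^2(A_0^2+A_1^2-A_2^2-A_3^2-2A_0+1). \end{aligned}$$ For $\alpha=(\alpha_0,\alpha_1,\alpha_2,\alpha_3;\beta_1,\beta_2,\beta_3)$ put $\beta_0=1$ and, for $i=0,1,2,3$, $$y_i(\alpha)=\sum_{m\ge0}\prod_{l=0}^3\frac{\Gamma(\alpha_l+1-\beta_i+m)}{\Gamma(\beta_l+1-\beta_i+m)},\qquad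 y_{i+4}(\alpha)=-\sum_{m\ge0}\prod_{l=0}^3\frac{\Gamma(\alpha_i+1-\beta_l+m)}{\Gamma(\alpha_i+1-\alpha_l+m)}.$$ Put $(n;\alpha)=(\alpha_0-n,\alpha_1-n,\alpha_2,\alpha_3;\beta_1-n,\beta_2-n,\beta_3)$ and $D_{ij}(n;\alpha)=y_i(n;\alpha)-y_j(n;\alpha)$. Write $A_{\varepsilon_0\varepsilon_1\varepsilon_2\varepsilon_3}=\frac12(\varepsilon_0A_0+\varepsilon_1A_1+\varepsilon_2A_2+\varepsilon_3A_3+1)$ with signs $\varepsilon_j=\pm$, let $(z)_n=z(z+1)\cdots(z+n-1)$, and let $$\begin{aligned} \alpha^{(1)}&=(\tfrac12,\,A_0+\tfrac12,\,A_{+---},\,A_{+-++};\ A_{+--+}+\tfrac12,\,A_{+-+-}+\tfrac12,\,A_0+1),\\ \alpha^{(2)}&=(\tfrac12,\,A_2+\tfrac12,\,A_{--+-},\,A_{+-++};\ A_{--++}+\tfrac12,\,A_{+-+-}+\tfrac12,\,A_2+1),\\ \alpha^{(3)}&=(A_0+\tfrac12,\,A_2+\tfrac12,\,A_{+-++},\,A_{+-+-};\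 A_{+-++}+\tfrac12,\,A_{+-+-}+\tfrac12,\,A_0+A_2+1),\\ \alpha^{(4)}&=(A_2+\tfrac12,\,A_3+\tfrac12,\,A_{+-++},\,A_{--++};\ A_{+-++}+\tfrac12,\,A_{--++}+\tfrac12,\,A_2+A_3+1). \end{aligned}$$ Let $W^{(1)}_{k,ij}(n;A)=r_k(n)\,D_{ij}(n;\alpha^{(k)})$ with $$r_1=\frac{(\frac12)_n}{n!},\quad r_2=\frac{(\frac12)_n(\frac12-A_2)_n(\frac12+A_2)_n}{n!\,(\frac12-A_0)_n(\frac12+A_0)_n},\quad r_3=\frac{(\frac12-A_2)_n(\frac12+A_2)_n}{n!\,(\frac12)_n},\quad r_4=\frac{(\frac12-A_2)_n(\frac12+A_2)_n(\frac12-A_3)_n(\frac12+A_3)_n}{n!\,(\frac12)_n(\frac12-A_0)_n(\frac12+A_0)_n}.$$ Let $k\in\{1,2,3,4\}$ and $i\ne j$ in $\{0,\dots,7\}$. Call $A$ *admissible* for $(k,i,j)$ if, for all $n\ge0$, no argument (at $m=0$) of a Gamma function in the numerators of $y_i(n;\alpha^{(k)})$ and $y_j(n;\alpha^{(k)})$ lies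 in $\{0,-1,-2,\dots\}$, and the denominator of $r_k(n)$ is nonzero. (A value $1/\Gamma$ at a pole of $\Gamma$ is $0$.) (a) If $A$ is admissible, then the series defining $y_i(n;\alpha^{(k)})$ and $y_j(n;\alpha^{(k)})$ converge absolutely for every $n\ge 0$; the power series $\sum_{n\ge0}W^{(1)}_{k,ij}(n;A)x^n$ converges for $|x|<1$ to a holomorphic function, with value $W^{(1)}_{k,ij}(0;A)$ at $x=0$; and $$f^{(0,A_0-1/2)}_{k,ij}(A;x)=x^{A_0-\frac12}\sum_{n=0}^\infty W^{(1)}_{k,ij}(n;A)x^n$$ is a solution of $Z(A)$: on every open $U\subseteq\{0<|x|<1\}$, for every holomorphic branch of $\log x$ on $U$ (which fixes $x^{A_0-1/2}=e^{(A_0-1/2)\log x}$), it is holomorphic and satisfies $Z(A)$. (b) The set of admissible $A$ with $W^{(1)}_{k,ij}(0;A)\neq0$, for which the exponent of this solution at $x=0$ is exactly $A_0-\frac12$, is dense in $\mathbb C^4$. -/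

import Mathlib

open scoped BigOperators

noncomputable section

namespace ZEq

/-! ### The differential equation `Z(A)` in the variable `x`; `A = (A₀, A₁, A₂, A₃)` -/

def p0 (x : ℂ) : ℂ := x ^ 3 * (x - 1) ^ 2

def p1 (A : Fin 4 → ℂ) (x : ℂ) : ℂ :=
  -2 * x ^ 2 * (x - 1) * (2 * A 0 * x - 2 * A 0 - 5 * x + 3)

def p2 (A : Fin 4 → ℂ) (x : ℂ) : ℂ :=
  x * ((6 * A 0 ^ 2 - A 2 ^ 2 - A 3 ^ 2 - 24 * A 0 + 25) * x ^ 2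
    + (-11 * A 0 ^ 2 - A 1 ^ 2 + A 2 ^ 2 + A 3 ^ 2 + 36 * A 0 - 59 / 2) * x
    + (10 * A 0 - 9) * (2 * A 0 - 3) / 4)

def p3 (A : Fin 4 → ℂ) (x : ℂ) : ℂ :=
  -(2 * A 0 - 3) * (2 * A 0 ^ 2 - A 2 ^ 2 - A 3 ^ 2 - 6 * A 0 + 5) * x ^ 2
    + (A 0 - 1) * (6 * A 0 ^ 2 + 2 * A 1 ^ 2 - 2 * A 2 ^ 2 - 2 * A 3 ^ 2 - 16 * A 0 + 11) * x
    + -((2 * A 0 - 3) * (2 * A 0 - 1) ^ 2) / 4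

def p4 (A : Fin 4 → ℂ) (x : ℂ) : ℂ :=
  (A 0 - 1 + A 3) * (A 0 - 1 - A 3) * (A 0 - 1 + A 2) * (A 0 - 1 - A 2) * x
    + -((2 * A 0 - 1) ^ 2 * (A 0 ^ 2 + A 1 ^ 2 - A 2 ^ 2 - A 3 ^ 2 - 2 * A 0 + 1)) / 4

/-- `f` is a holomorphic solution of `Z(A)` on the (open) set `U`. -/
def Solves (A : Fin 4 → ℂ) (U : Set ℂ) (f : ℂ → ℂ) : Prop :=
  DifferentiableOn ℂ f U ∧
    ∀ x ∈ U, p0 x * iteratedDeriv 4 f x + p1 A x * iteratedDeriv 3 f x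
      + p2 A x * iteratedDeriv 2 f x + p3 A x * iteratedDeriv 1 f x + p4 A x * f x = 0

/-! ### Values at `1` of non-terminating series of type `₄F₃` -/

/-- `∏ Γ(a_l + m) / ∏ Γ(b_l + m)`. Mathlib's `Gamma` is `0` at its poles, so a factor
`Γ(b_l + m)` at a pole makes the quotient `0`, as it should be (`1/Γ` vanishes there). -/
def term (a b : Fin 4 → ℂ) (m : ℕ) : ℂ :=
  (∏ l, Complex.Gamma (a l + m)) / ∏ l, Complex.Gamma (b l + m)

/-- The series `₄f̃₃(a; b; x)`. -/
def f43 (a b : Fin 4 → ℂ) (x : ℂ) : ℂ := ∑' m : ℕ, term a b m * x ^ m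

/-- Parameters `(α₀, α₁, α₂, α₃; β₁, β₂, β₃)`, written `up l = α_l` and `lo 0 = β₁`,
`lo 1 = β₂`, `lo 2 = β₃`. -/
structure Params where
  up : Fin 4 → ℂ
  lo : Fin 3 → ℂ

/-- The lower row completed by `β₀ = 1`, that is `(1, β₁, β₂, β₃)`. -/
def Params.beta (α : Params) : Fin 4 → ℂ := ![1, α.lo 0, α.lo 1, α.lo 2]

/-- The shift `(n; α) = α - n e₁₂`, where `e₁₂ = (1,1,0,0; 1,1,0)`. -/
def Params.shift (n : ℕ) (α : Params) : Params where
  up := ![α.up 0 - n, α.up 1 - n, α.up 2, α.up 3]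
  lo := ![α.lo 0 - n, α.lo 1 - n, α.lo 2]

/-- Upper parameters of the series `y_i`. With `β₀ = 1` they are `α_l + 1 - β_i` (`l = 0,…,3`)
for `i = 0,…,3`, and `α_{i-4} + 1 - β_l` (`l = 0,…,3`) for `i = 4,…,7`. -/
def upperRow (α : Params) (i : Fin 8) : Fin 4 → ℂ :=
  if h : i.val < 4 then fun l => α.up l + 1 - α.beta ⟨i.val, h⟩
  else fun l => α.up ⟨i.val - 4, by omega⟩ + 1 - α.beta l

/-- Lower parameters of the series `y_i`. With `β₀ = 1` they are `β_l + 1 - β_i` (`l = 0,…,3`)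
for `i = 0,…,3`, and `α_{i-4} + 1 - α_l` (`l = 0,…,3`) for `i = 4,…,7`. -/
def lowerRow (α : Params) (i : Fin 8) : Fin 4 → ℂ :=
  if h : i.val < 4 then fun l => α.beta l + 1 - α.beta ⟨i.val, h⟩
  else fun l => α.up ⟨i.val - 4, by omega⟩ + 1 - α.up l

/-- `y_i(α)`, `i = 0,…,7`. -/
def y (i : Fin 8) (α : Params) : ℂ :=
  (if i.val < 4 then 1 else -1) * f43 (upperRow α i) (lowerRow α i) 1

/-! ### The coefficients `W_{k,ij}(n; A)` -/

/-- `A_{ε₀ε₁ε₂ε₃} = (ε₀A₀ + ε₁A₁ + ε₂A₂ + ε₃A₃ + 1)/2`, signs `ε = ±1`. -/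
def sgn (A : Fin 4 → ℂ) (e0 e1 e2 e3 : ℂ) : ℂ :=
  (e0 * A 0 + e1 * A 1 + e2 * A 2 + e3 * A 3 + 1) / 2

/-- The four parameter families; `k = 0, 1, 2, 3` here are the first, …, fourth family. -/
def family (A : Fin 4 → ℂ) : Fin 4 → Params
  | 0 => ⟨![1 / 2, A 0 + 1 / 2, sgn A 1 (-1) (-1) (-1), sgn A 1 (-1) 1 1],
          ![sgn A 1 (-1) (-1) 1 + 1 / 2, sgn A 1 (-1) 1 (-1) + 1 / 2, A 0 + 1]⟩
  | 1 => ⟨![1 / 2, A 2 + 1 / 2, sgn A (-1) (-1) 1 (-1), sgn A 1 (-1) 1 1],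
          ![sgn A (-1) (-1) 1 1 + 1 / 2, sgn A 1 (-1) 1 (-1) + 1 / 2, A 2 + 1]⟩
  | 2 => ⟨![A 0 + 1 / 2, A 2 + 1 / 2, sgn A 1 (-1) 1 1, sgn A 1 (-1) 1 (-1)],
          ![sgn A 1 (-1) 1 1 + 1 / 2, sgn A 1 (-1) 1 (-1) + 1 / 2, A 0 + A 2 + 1]⟩
  | 3 => ⟨![A 2 + 1 / 2, A 3 + 1 / 2, sgn A 1 (-1) 1 1, sgn A (-1) (-1) 1 1],
          ![sgn A 1 (-1) 1 1 + 1 / 2, sgn A (-1) (-1) 1 1 + 1 / 2, A 2 + A 3 + 1]⟩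

/-- Pochhammer symbol `(z)_n = z (z+1) ⋯ (z+n-1)`. -/
def poch (z : ℂ) (n : ℕ) : ℂ := (ascPochhammer ℂ n).eval z

/-- Numerators of the Pochhammer ratios. -/
def ratioNum (A : Fin 4 → ℂ) (n : ℕ) : Fin 4 → ℂ
  | 0 => poch (1 / 2) n
  | 1 => poch (1 / 2) n * poch (-A 2 + 1 / 2) n * poch (A 2 + 1 / 2) n
  | 2 => poch (-A 2 + 1 / 2) n * poch (A 2 + 1 / 2) n
  | 3 => poch (-A 2 + 1 / 2) n * poch (A 2 + 1 / 2) n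
          * poch (-A 3 + 1 / 2) n * poch (A 3 + 1 / 2) n

/-- Denominators of the Pochhammer ratios. -/
def ratioDen (A : Fin 4 → ℂ) (n : ℕ) : Fin 4 → ℂ
  | 0 => n.factorial
  | 1 => n.factorial * poch (-A 0 + 1 / 2) n * poch (A 0 + 1 / 2) n
  | 2 => n.factorial * poch (1 / 2) n
  | 3 => n.factorial * poch (1 / 2) n * poch (-A 0 + 1 / 2) n * poch (A 0 + 1 / 2) n

/-- `W_{k,ij}(n; A)`: the Pochhammer ratio times `y_i(n; α) - y_j(n; α)`, with `α` the `k`-th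
family. -/
def W (k : Fin 4) (i j : Fin 8) (n : ℕ) (A : Fin 4 → ℂ) : ℂ :=
  ratioNum A n k / ratioDen A n k *
    (y i ((family A k).shift n) - y j ((family A k).shift n))

/-- All `W_{k,ij}(n; A)` are given by meaningful expressions: no Gamma function in a numerator is
taken at a pole `0, -1, -2, …`, and no Pochhammer denominator vanishes. -/
def Admissible (k : Fin 4) (i j : Fin 8) (A : Fin 4 → ℂ) : Prop :=
  (∀ (n m : ℕ) (l : Fin 4), upperRow ((family A k).shift n) i l ≠ -(m : ℂ) ∧
    upperRow ((family A k).shift n) j l ≠ -(m : ℂ)) ∧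
  ∀ n : ℕ, ratioDen A n k ≠ 0

/-- The power series `∑ W_{k,ij}(n; A) xⁿ`. -/
def S (k : Fin 4) (i j : Fin 8) (A : Fin 4 → ℂ) (x : ℂ) : ℂ :=
  ∑' n : ℕ, W k i j n A * x ^ n

/-- `f_{k,ij}(A; x) = x^{A₀ - 1/2} ∑ W_{k,ij}(n; A) xⁿ`, where the power of `x` is formed with the
branch `L` of the logarithm. -/
def f (k : Fin 4) (i j : Fin 8) (A : Fin 4 → ℂ) (L : ℂ → ℂ) (x : ℂ) : ℂ :=
  Complex.exp ((A 0 - 1 / 2) * L x) * S k i j A x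

end ZEq

end

/-!
Put `ρ = A₀ - 1/2`. For `w : ℕ → ℂ` the operator of `Z(A)`, applied to `x ^ ρ * ∑ w n * x ^ n`,
gives `x ^ (ρ - 1)` times
`∑ Pm A n * w n * x ^ n + x * ∑ Pz A n * w n * x ^ n + x ^ 2 * ∑ Pp A n * w n * x ^ n`, where
`Pm`, `Pz`, `Pp` are polynomials of degree four in `n`. As `Pm` is divisible by `n * (n - 1)` and
`Pz` by `n ^ 2`, the equation amounts to
`Pm A (n + 2) * w (n + 2) + Pz A (n + 1) * w (n + 1) + Pp A n * w n = 0` for all `n ≥ 0`, without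
an indicial condition on `w 0` and `w 1` (`solves_of_recurrence`). The leading coefficients of the
three polynomials are `1`, `-2`, `1`, so a solution `w` grows subexponentially and the power
series converges in the unit disc (`subexp_of_recurrence`).

So everything rests on the recurrence for `W_{k,ij}(n; A)`. Each of `y_0, …, y_3` is a sum of
`∏ Γ(α_l + s) / ∏ Γ(β_l + s)` over `s ∈ 1 - β_i + ℕ`, and `y_4, …, y_7` are of the same form, up
to sign, for the dual parameters `-β`, `-α`. A *certificate* (`IsCert`) is a polynomial identity
by which a combination of this summand and of its two neighbours under `α ↦ α ∓ (1,1,0,0; 1,1,0)`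
is a difference `G (s + 1) - G s`. When the sum telescopes, the lower end contributes `0`, because
of a factor `1 / Γ` at a pole, and the upper end contributes a constant that depends neither on
`i` nor on passing to the dual, since the sign of the constant and the sign of the series both
change. Hence all eight `y_i` satisfy the same inhomogeneous three-term relation (`y_relation`),
and the differences `y_i - y_j` satisfy the homogeneous one. One explicit certificate
(`hasCert_base`) serves all four families, by translation of `s`, by duality, and by permuting the
`A_l` and changing their signs.

The telescoping needs parameters without integral differences `α_l - β_l'`. On a complex line in a
generic direction these are all parameters but countably many, so the recurrence follows for every
admissible `A` by continuity; continuity holds because the series, divided by the Gamma values at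
its upper parameters, is entire in the parameters (`differentiable_tsum_regTerm`).

For density, `W_{k,ij}(0; A)` is a product of Gamma values times a function `crossReg` that is
entire in `A`. It suffices that `crossReg` does not vanish identically: then on a line through a
generic point and a point where `crossReg ≠ 0` all but countably many points are good. Such a
point is found where a single difference `α_p - β_q` that enters `y_i` and not `y_j` equals `-1`
and everything else is generic: there the regularized series of `y_i` reduces to its first term
and the one of `y_j` is multiplied by `1 / Γ(0) = 0`.
-/

open scoped BigOperators

namespace ZEq

open Filter Topology Complex

/-! ### Terms of the series, divided by their Gamma factors -/

lemma Gamma_add_nat_eq {a : ℂ} (ha : ∀ m : ℕ, a ≠ -(m : ℂ)) (m : ℕ) :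
    Gamma (a + m) = (ascPochhammer ℂ m).eval a * Gamma a := by
  rw [← Complex.Gamma_add_nat_div_Gamma_eq a ha, div_mul_cancel₀ _ (Gamma_ne_zero ha)]

/-- The summand `term a b m` divided by `∏ Γ(a_l)`. It is entire in `a` and `b`: the quotients
`Γ(a_l + m) / Γ(a_l)` are Pochhammer polynomials, and `Γ⁻¹` is entire. -/
noncomputable def regTerm (a b : Fin 4 → ℂ) (m : ℕ) : ℂ :=
  (∏ l, (ascPochhammer ℂ m).eval (a l)) * ∏ l, (Gamma (b l + m))⁻¹

lemma term_eq_prod_Gamma_mul_regTerm {a : Fin 4 → ℂ} (ha : ∀ l (m : ℕ), a l ≠ -(m : ℂ))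
    (b : Fin 4 → ℂ) (m : ℕ) : term a b m = (∏ l, Gamma (a l)) * regTerm a b m := by
  simp only [term, regTerm, fun l => Gamma_add_nat_eq (ha l) m, Finset.prod_mul_distrib,
    Finset.prod_inv_distrib]
  ring

lemma regTerm_succ {a b : Fin 4 → ℂ} {m : ℕ} (hb : ∀ l, b l + m ≠ 0) :
    regTerm a b (m + 1) = regTerm a b m * ∏ l, (a l + m) / (b l + m) := by
  have h1 : ∀ l, (ascPochhammer ℂ (m + 1)).eval (a l) =
      (ascPochhammer ℂ m).eval (a l) * (a l + m) := fun l => by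
    rw [ascPochhammer_succ_eval]
  have h2 : ∀ l, (Gamma (b l + (m + 1 : ℕ)))⁻¹ = (Gamma (b l + m))⁻¹ * (b l + m)⁻¹ := fun l => by
    rw [one_div_Gamma_eq_self_mul_one_div_Gamma_add_one (b l + m)]
    push_cast
    rw [← add_assoc]
    field_simp [hb l]
  simp only [regTerm, h1, h2, Finset.prod_mul_distrib, div_eq_mul_inv]
  ring

/-- From `‖a + m‖ ^ 2 = m ^ 2 * (1 + 2 * a.re / m + ‖a‖ ^ 2 / m ^ 2)` and `1 + t ≤ exp t`. -/
lemma norm_add_nat_le {a : ℂ} {R : ℝ} (ha : ‖a‖ ≤ R) {m : ℕ} (hm : 0 < m) :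
    ‖a + m‖ ≤ m * Real.exp (a.re / m + R ^ 2 / m ^ 2) := by
  have hm' : (0 : ℝ) < m := by exact_mod_cast hm
  have hR : ‖a‖ ^ 2 ≤ R ^ 2 := by gcongr
  refine le_of_sq_le_sq ?_ (by positivity)
  have h1 : ‖a + m‖ ^ 2 = m ^ 2 * (2 * (a.re / m) + ‖a‖ ^ 2 / m ^ 2 + 1) := by
    rw [Complex.sq_norm, Complex.sq_norm, Complex.normSq_apply, Complex.normSq_apply]
    simp
    field_simp
    ring
  rw [h1, mul_pow, ← Real.exp_nat_mul]
  refine mul_le_mul_of_nonneg_left ((Real.add_one_le_exp _).trans (Real.exp_le_exp.2 ?_))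
    (by positivity)
  have h2 : ‖a‖ ^ 2 / m ^ 2 ≤ R ^ 2 / m ^ 2 := by gcongr
  have h3 : 0 ≤ R ^ 2 / (m : ℝ) ^ 2 := by positivity
  push_cast
  linarith

lemma inv_norm_add_nat_le {b : ℂ} {R : ℝ} (hb : ‖b‖ ≤ R) {m : ℕ} (hm : 0 < m)
    (hmR : 2 * R ≤ m) :
    ‖b + m‖⁻¹ ≤ (m : ℝ)⁻¹ * Real.exp (-(b.re / m) + 2 * (R ^ 2 / m ^ 2)) := by
  have hm' : (0 : ℝ) < m := by exact_mod_cast hm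
  set x : ℝ := b.re / m with hx
  have hre : |b.re| ≤ R := (Complex.abs_re_le_norm b).trans hb
  have hx1 : |x| ≤ R / m := by
    rw [hx, abs_div, abs_of_pos hm']; gcongr
  have hx2 : R / m ≤ 1 / 2 := by rw [div_le_div_iff₀ hm' two_pos]; linarith
  have hxl : -(1 / 2) ≤ x := by have := neg_abs_le x; linarith
  have hxs : x ^ 2 ≤ R ^ 2 / m ^ 2 := by
    rw [← div_pow, ← sq_abs x]; gcongr
  have h1 : m * (1 + x) ≤ ‖b + m‖ := by
    refine le_trans (le_of_eq ?_) (Complex.re_le_norm _)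
    simp [hx]; field_simp; ring
  have hpos : 0 < 1 + x := by linarith
  have h2 : ‖b + m‖⁻¹ ≤ (m * (1 + x))⁻¹ := inv_anti₀ (by positivity) h1
  refine h2.trans ?_
  rw [mul_inv]
  refine mul_le_mul_of_nonneg_left ?_ (by positivity)
  have h3 : (1 + x)⁻¹ = (-x / (1 + x)) + 1 := by field_simp; ring
  rw [h3]
  refine (Real.add_one_le_exp _).trans (Real.exp_le_exp.2 ?_)
  rw [div_le_iff₀ hpos]
  nlinarith [sq_nonneg x, mul_nonneg (sq_nonneg x) (by linarith : 0 ≤ x + 1 / 2)]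

/-- The linear terms of the two preceding bounds add up to `Re (∑ a_l - ∑ b_l) / m = -2 / m`; for
large `m` the quadratic ones cost at most `1 / (2 * m)`. -/
lemma norm_regTerm_ratio_le {a b : Fin 4 → ℂ} {R : ℝ} (ha : ∀ l, ‖a l‖ ≤ R)
    (hb : ∀ l, ‖b l‖ ≤ R) (hab : ∑ l, a l - ∑ l, b l = -2) {m : ℕ} (hm : 0 < m)
    (hmR : 2 * R ≤ m) (hmR' : 24 * R ^ 2 ≤ m) :
    ‖∏ l, (a l + m) / (b l + m)‖ ≤ Real.exp (-3 / (2 * m)) := by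
  have hm' : (0 : ℝ) < m := by exact_mod_cast hm
  have h1 : ∀ l, ‖(a l + m) / (b l + m)‖ ≤
      Real.exp ((a l).re / m - (b l).re / m + 3 * (R ^ 2 / m ^ 2)) := fun l => by
    rw [norm_div, div_eq_mul_inv]
    refine (mul_le_mul (norm_add_nat_le (ha l) hm) (inv_norm_add_nat_le (hb l) hm hmR)
      (by positivity) (by positivity)).trans (le_of_eq ?_)
    rw [mul_mul_mul_comm, mul_inv_cancel₀ hm'.ne', one_mul, ← Real.exp_add]
    congr 1
    ring
  rw [norm_prod]
  refine (Finset.prod_le_prod (fun _ _ => norm_nonneg _) fun l _ => h1 l).trans ?_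
  rw [← Real.exp_sum, Real.exp_le_exp, Finset.sum_add_distrib, Finset.sum_sub_distrib,
    ← Finset.sum_div, ← Finset.sum_div, ← Complex.re_sum, ← Complex.re_sum, ← sub_div,
    ← Complex.sub_re, hab]
  simp
  have h2 : R ^ 2 / (m : ℝ) ^ 2 ≤ 1 / (24 * m) := by
    rw [div_le_div_iff₀ (by positivity) (by positivity)]
    nlinarith
  have h3 : 1 / (24 * (m : ℝ)) = (1 / m) / 24 := by field_simp
  have h4 : -2 / (m : ℝ) = -2 * (1 / m) := by ring
  have h5 : -3 / (2 * (m : ℝ)) = -(3 / 2) * (1 / m) := by field_simp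
  rw [h4, h5]
  linarith

lemma exists_norm_regTerm_le (R : ℝ) (m : ℕ) : ∃ B : ℝ, ∀ a b : Fin 4 → ℂ,
    (∀ l, ‖a l‖ ≤ R) → (∀ l, ‖b l‖ ≤ R) → ‖regTerm a b m‖ ≤ B := by
  obtain ⟨C, hC⟩ := (isCompact_closedBall (0 : ℂ) R).exists_bound_of_continuousOn
    (f := fun z => (ascPochhammer ℂ m).eval z) (Polynomial.continuous _).continuousOn
  obtain ⟨D, hD⟩ := (isCompact_closedBall (0 : ℂ) R).exists_bound_of_continuousOn
    (f := fun z => (Gamma (z + m))⁻¹)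
    (differentiable_one_div_Gamma.continuous.comp (continuous_id.add_const _)).continuousOn
  refine ⟨C ^ 4 * D ^ 4, fun a b ha hb => ?_⟩
  rw [regTerm, norm_mul, norm_prod, norm_prod]
  have h1 : ∏ l, ‖(ascPochhammer ℂ m).eval (a l)‖ ≤ ∏ _l : Fin 4, C :=
    Finset.prod_le_prod (fun _ _ => norm_nonneg _) fun l _ => hC _ (by simpa using ha l)
  have h2 : ∏ l, ‖(Gamma (b l + m))⁻¹‖ ≤ ∏ _l : Fin 4, D :=
    Finset.prod_le_prod (fun _ _ => norm_nonneg _) fun l _ => hD _ (by simpa using hb l)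
  simp only [Finset.prod_const, Finset.card_univ, Fintype.card_fin] at h1 h2
  exact mul_le_mul h1 h2 (Finset.prod_nonneg fun _ _ => norm_nonneg _) (by positivity)

/-- For bounded balanced parameters the regularized terms are dominated by one summable sequence,
a multiple of `m ^ (-3/2)` for large `m`. The true order is `m ^ (-2)`; the smaller exponent
leaves room for uniformity in the parameters. -/
lemma exists_summable_majorant (R : ℝ) : ∃ u : ℕ → ℝ, Summable u ∧ ∀ a b : Fin 4 → ℂ,
    (∀ l, ‖a l‖ ≤ R) → (∀ l, ‖b l‖ ≤ R) → ∑ l, a l - ∑ l, b l = -2 →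
      ∀ m, ‖regTerm a b m‖ ≤ u m := by
  choose B hB using exists_norm_regTerm_le R
  obtain ⟨N, hN⟩ := exists_nat_ge (max 1 (max (2 * R + 1) (24 * R ^ 2)))
  have hN1 : (1 : ℝ) ≤ N := (le_max_left _ _).trans hN
  have hN2 : 2 * R + 1 ≤ (N : ℝ) := ((le_max_left _ _).trans (le_max_right _ _)).trans hN
  have hN3 : 24 * R ^ 2 ≤ (N : ℝ) := ((le_max_right _ _).trans (le_max_right _ _)).trans hN
  have hNpos : 0 < N := by exact_mod_cast (zero_lt_one.trans_le hN1)
  -- Beyond `N` the ratio of consecutive terms is at most `(m / (m + 1)) ^ (3/2)`.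
  refine ⟨fun m => if m < N then B m else B N * (N : ℝ) ^ (3 / 2 : ℝ) * (1 / (m : ℝ) ^ (3 / 2 : ℝ)),
    ?_, fun a b ha hb hab m => ?_⟩
  · have h1 : Summable fun m : ℕ => B N * (N : ℝ) ^ (3 / 2 : ℝ) * (1 / (m : ℝ) ^ (3 / 2 : ℝ)) :=
      (Real.summable_one_div_nat_rpow.2 (by norm_num)).mul_left _
    refine (summable_nat_add_iff N).1 (((summable_nat_add_iff N).2 h1).congr fun m => ?_)
    rw [if_neg (by omega)]
  · beta_reduce
    split_ifs with h
    · exact hB m a b ha hb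
    · push Not at h
      induction m, h using Nat.le_induction with
      | base =>
        have h2 : ((N : ℝ) ^ (3 / 2 : ℝ)) ≠ 0 := by positivity
        rw [mul_assoc, mul_one_div_cancel h2, mul_one]
        exact hB N a b ha hb
      | succ m hm ih =>
        have hmN : (N : ℝ) ≤ m := by exact_mod_cast hm
        have hmpos : (0 : ℝ) < m := by linarith
        have hne : ∀ l, b l + m ≠ 0 := fun l h0 => by
          have h3 : (m : ℝ) = ‖b l‖ := by
            rw [eq_neg_of_add_eq_zero_left h0, norm_neg, Complex.norm_natCast]
          have := hb l
          have h0 := norm_nonneg (b l)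
          linarith
        rw [regTerm_succ hne, norm_mul]
        have h4 := norm_regTerm_ratio_le ha hb hab (hNpos.trans_le hm) (by linarith) (by linarith)
        have h5 : Real.exp (-3 / (2 * m)) ≤
            (m : ℝ) ^ (3 / 2 : ℝ) / ((m : ℝ) + 1) ^ (3 / 2 : ℝ) := by
          rw [← Real.div_rpow hmpos.le (by positivity)]
          have h6 : Real.exp (-1 / m) ≤ m / (m + 1) := by
            have h7 : (m + 1) / m ≤ Real.exp (1 / (m : ℝ)) := by
              refine le_trans (le_of_eq ?_) (Real.add_one_le_exp _)
              field_simp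
              ring
            rw [neg_div, Real.exp_neg, ← inv_div ((m : ℝ) + 1) m]
            exact inv_anti₀ (by positivity) h7
          calc Real.exp (-3 / (2 * m)) = Real.exp (-1 / m) ^ (3 / 2 : ℝ) := by
                rw [← Real.exp_mul]; congr 1; field_simp
            _ ≤ _ := Real.rpow_le_rpow (by positivity) h6 (by norm_num)
        refine (mul_le_mul ih (h4.trans h5) (norm_nonneg _)
          ((norm_nonneg _).trans ih)).trans (le_of_eq ?_)
        have h8 : ((m : ℝ) ^ (3 / 2 : ℝ)) ≠ 0 := by positivity
        push_cast
        field_simp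

lemma summable_regTerm {a b : Fin 4 → ℂ} (hab : ∑ l, a l - ∑ l, b l = -2) :
    Summable (regTerm a b) := by
  obtain ⟨u, hu, h⟩ := exists_summable_majorant (∑ l, ‖a l‖ + ∑ l, ‖b l‖)
  refine Summable.of_norm_bounded hu (h a b (fun l => ?_) (fun l => ?_) hab)
  · have h1 := Finset.single_le_sum (f := fun l => ‖a l‖) (fun i _ => norm_nonneg _)
      (Finset.mem_univ l)
    have h2 : 0 ≤ ∑ l, ‖b l‖ := Finset.sum_nonneg fun _ _ => norm_nonneg _
    linarith
  · have h1 := Finset.single_le_sum (f := fun l => ‖b l‖) (fun i _ => norm_nonneg _)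
      (Finset.mem_univ l)
    have h2 : 0 ≤ ∑ l, ‖a l‖ := Finset.sum_nonneg fun _ _ => norm_nonneg _
    linarith

lemma summable_term {a b : Fin 4 → ℂ} (ha : ∀ l (m : ℕ), a l ≠ -(m : ℂ))
    (hab : ∑ l, a l - ∑ l, b l = -2) : Summable (term a b) :=
  ((summable_regTerm hab).mul_left _).congr fun m =>
    (term_eq_prod_Gamma_mul_regTerm ha b m).symm

/-- The regularized sum is entire along any holomorphic family of balanced parameters. -/
lemma differentiable_tsum_regTerm {a b : ℂ → Fin 4 → ℂ}
    (ha : ∀ l, Differentiable ℂ fun z => a z l) (hb : ∀ l, Differentiable ℂ fun z => b z l)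
    (hab : ∀ z, ∑ l, a z l - ∑ l, b z l = -2) :
    Differentiable ℂ fun z => ∑' m, regTerm (a z) (b z) m := by
  intro z₀
  have key : ∀ c : ℂ → Fin 4 → ℂ, (∀ l, Differentiable ℂ fun z => c z l) →
      ∃ R : ℝ, ∀ z ∈ Metric.closedBall z₀ 1, ∀ l, ‖c z l‖ ≤ R := fun c hc => by
    obtain ⟨R, hR⟩ := (isCompact_closedBall z₀ 1).exists_bound_of_continuousOn
      (f := c) (continuous_pi fun l => (hc l).continuous).continuousOn
    exact ⟨R, fun z hz l => (norm_le_pi_norm _ l).trans (hR z hz)⟩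
  obtain ⟨R₁, h₁⟩ := key a ha
  obtain ⟨R₂, h₂⟩ := key b hb
  obtain ⟨u, hu, hle⟩ := exists_summable_majorant (max R₁ R₂)
  have := differentiableOn_tsum_of_summable_norm (F := fun m z => regTerm (a z) (b z) m)
    (U := Metric.ball z₀ 1) hu (fun m => Differentiable.differentiableOn ?_) Metric.isOpen_ball
    (fun m z hz => hle _ _
      (fun l => (h₁ z (Metric.ball_subset_closedBall hz) l).trans (le_max_left _ _))
      (fun l => (h₂ z (Metric.ball_subset_closedBall hz) l).trans (le_max_right _ _)) (hab z) m)
  · exact this.differentiableAt (Metric.isOpen_ball.mem_nhds (Metric.mem_ball_self one_pos))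
  · unfold regTerm
    refine Differentiable.mul (Differentiable.fun_finsetProd fun l _ => ?_)
      (Differentiable.fun_finsetProd fun l _ => ?_)
    · exact (Polynomial.differentiable _).comp (ha l)
    · exact differentiable_one_div_Gamma.comp ((hb l).add_const _)

/-! ### Asymptotics of the terms -/

/-- Euler's limit formula for `Γ(s)`, read as an asymptotic formula for `Γ(s + n + 1)`. -/
lemma tendsto_Gamma_ratio_of_ne {s : ℂ} (hs : ∀ m : ℕ, s ≠ -(m : ℂ)) :
    Tendsto (fun n : ℕ => Gamma (s + n + 1) / ((n : ℂ) ^ s * n.factorial)) atTop (𝓝 1) := by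
  have h1 := (tendsto_const_nhds (x := Gamma s)).div (GammaSeq_tendsto_Gamma s) (Gamma_ne_zero hs)
  rw [div_self (Gamma_ne_zero hs)] at h1
  refine h1.congr fun n => ?_
  have h2 : ∀ n : ℕ, (ascPochhammer ℂ n).eval s = ∏ j ∈ Finset.range n, (s + j) := fun n => by
    induction n with
    | zero => simp
    | succ n ih => rw [ascPochhammer_succ_eval, ih, Finset.prod_range_succ]
  have h3 : Gamma (s + n + 1) = (∏ j ∈ Finset.range (n + 1), (s + j)) * Gamma s := by
    rw [← h2, ← Gamma_add_nat_eq hs]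
    push_cast
    rw [add_assoc]
  simp only [Pi.div_apply]
  rw [h3, GammaSeq, div_div_eq_mul_div, mul_comm (Gamma s)]

/-- The poles of `Γ` are reached from `tendsto_Gamma_ratio_of_ne` by the functional equation. -/
lemma tendsto_Gamma_ratio (s : ℂ) :
    Tendsto (fun n : ℕ => Gamma (s + n + 1) / ((n : ℂ) ^ s * n.factorial)) atTop (𝓝 1) := by
  obtain ⟨N, hN⟩ := exists_nat_gt (-s.re)
  induction N generalizing s with
  | zero =>
    refine tendsto_Gamma_ratio_of_ne fun m hm => ?_
    rw [hm] at hN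
    simp at hN
    have : (0 : ℝ) ≤ m := m.cast_nonneg
    linarith
  | succ N ih =>
    have h1 := ih (s + 1) (by simp at hN ⊢; linarith)
    have h2 : Tendsto (fun n : ℕ => (n : ℂ) / (s + 1 + n)) atTop (𝓝 1) := by
      simpa [add_comm] using tendsto_natCast_div_add_atTop (s + 1)
    have h3 := h1.mul h2
    rw [mul_one] at h3
    refine h3.congr' ?_
    obtain ⟨M, hM⟩ := exists_nat_gt ‖s + 1‖
    filter_upwards [eventually_ge_atTop M, eventually_gt_atTop 0] with n hn hn0
    have hn0' : (n : ℂ) ≠ 0 := by exact_mod_cast hn0.ne'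
    have hne : s + 1 + n ≠ 0 := fun h => by
      have h3 : (n : ℝ) = ‖s + 1‖ := by
        rw [eq_neg_of_add_eq_zero_left h, norm_neg, Complex.norm_natCast]
      have : (M : ℝ) ≤ n := by exact_mod_cast hn
      linarith
    have h4 : Gamma (s + 1 + n + 1) = (s + 1 + n) * Gamma (s + n + 1) := by
      rw [Gamma_add_one _ hne]; congr 2; ring
    have h5 : (n : ℂ) ^ (s + 1) = n ^ s * n := by rw [cpow_add _ _ hn0', cpow_one]
    have h6 : (n : ℂ) ^ s ≠ 0 := by simp [cpow_eq_zero_iff, hn0']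
    have h7 : (n.factorial : ℂ) ≠ 0 := by exact_mod_cast n.factorial_ne_zero
    rw [h4, h5]
    field_simp

/-- In the balanced case the terms are asymptotic to `m ^ (-2)` with constant `1`, for all
parameters. This is what makes the boundary term at infinity the same for all series. -/
lemma tendsto_sq_mul_term {a b : Fin 4 → ℂ} (hab : ∑ l, a l - ∑ l, b l = -2) :
    Tendsto (fun n : ℕ => (n : ℂ) ^ 2 * term a b (n + 1)) atTop (𝓝 1) := by
  have h1 := (tendsto_finsetProd Finset.univ fun l _ => tendsto_Gamma_ratio (a l)).div
    (tendsto_finsetProd Finset.univ fun l _ => tendsto_Gamma_ratio (b l)) (by simp)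
  simp only [Finset.prod_const_one, div_one] at h1
  refine h1.congr' ?_
  filter_upwards [eventually_gt_atTop 0] with n hn
  have hn' : (n : ℂ) ≠ 0 := by exact_mod_cast hn.ne'
  have h7 : (n.factorial : ℂ) ≠ 0 := by exact_mod_cast n.factorial_ne_zero
  have hp : ∀ c : Fin 4 → ℂ, ∏ l, (n : ℂ) ^ c l = (n : ℂ) ^ (∑ l, c l) := fun c => by
    rw [Complex.cpow_def_of_ne_zero hn', Finset.mul_sum, Complex.exp_sum]
    simp only [Complex.cpow_def_of_ne_zero hn']
  have hne : ∀ c : ℂ, (n : ℂ) ^ c ≠ 0 := fun c => by simp [cpow_eq_zero_iff, hn']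
  have h2 : (n : ℂ) ^ (∑ l, b l) = (n : ℂ) ^ (∑ l, a l) * n ^ 2 := by
    rw [← Complex.cpow_ofNat, ← cpow_add _ _ hn']
    congr 1
    linear_combination -hab
  simp only [Pi.div_apply, Finset.prod_div_distrib, Finset.prod_mul_distrib, hp, h2, term]
  have h8 : ∀ c : ℂ, c + (↑(n + 1) : ℂ) = c + n + 1 := fun c => by push_cast; ring
  simp only [h8]
  have := hne (∑ l, a l)
  rw [div_div_div_eq]
  have h9 : (∏ _l : Fin 4, (n.factorial : ℂ)) ≠ 0 := by simp [h7]
  generalize (∏ l, Gamma (a l + n + 1)) = X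
  generalize (∏ l, Gamma (b l + n + 1)) = Y
  rcases eq_or_ne Y 0 with rfl | hY
  · simp
  field_simp

/-! ### Certificates and telescoping -/

/-- The sum of `∏ Γ(α_l + s) / ∏ Γ(β_l + s)` over `s ∈ 1 - β_i + ℕ`. Since the summand vanishes
for the `s` that precede `1 - β_i`, the sum may start at any earlier `s`, or run over `-β_i + ℤ`.
-/
noncomputable def bilat (α β : Fin 4 → ℂ) (i : Fin 4) : ℂ :=
  ∑' m, term (fun l => α l + 1 - β i) (fun l => β l + 1 - β i) m

/-- The effect of `- ν e₁₂` on the row `(α₀, α₁, α₂, α₃)`. -/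
def shiftUp (ν : ℂ) (α : Fin 4 → ℂ) : Fin 4 → ℂ := ![α 0 - ν, α 1 - ν, α 2, α 3]

/-- The effect of `- ν e₁₂` on the row `(β₀, β₁, β₂, β₃)`, where `β₀` is kept. -/
def shiftLo (ν : ℂ) (β : Fin 4 → ℂ) : Fin 4 → ℂ := ![β 0, β 1 - ν, β 2 - ν, β 3]

/-- Certificate for the three-term relation with coefficients `cp`, `c0`, `cm`: after division by
the common Gamma factors, the combination of the summands for the shifts `1`, `0`, `-1` is the
forward difference in `s` of a hypergeometric term with polynomial part
`q0 + q1 * s + q2 * s ^ 2`. -/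
def IsCert (α β : Fin 4 → ℂ) (cp c0 cm q0 q1 q2 : ℂ) : Prop := ∀ s : ℂ,
  cp * ((β 1 - 1 + s) * (β 1 + s) * (β 2 - 1 + s) * (β 2 + s))
    + c0 * ((α 0 - 1 + s) * (α 1 - 1 + s) * (β 1 + s) * (β 2 + s))
    + cm * ((α 0 - 1 + s) * (α 0 + s) * (α 1 - 1 + s) * (α 1 + s))
  = (q0 + q1 * (s + 1) + q2 * (s + 1) ^ 2)
      * ((α 0 - 1 + s) * (α 1 - 1 + s) * (α 2 + s) * (α 3 + s))
    - (q0 + q1 * s + q2 * s ^ 2)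
      * ((β 0 - 1 + s) * (β 1 + s) * (β 2 + s) * (β 3 - 1 + s))

/-- Reversing the direction of summation, `s ↦ 1 - s`, turns upper parameters into negatives of
lower ones. The rows are ordered such that the shifted entries stand in the places they have for
`α`, `β`, and the shift changes its sign. -/
lemma IsCert.dual {α β : Fin 4 → ℂ} {cp c0 cm q0 q1 q2 : ℂ} (h : IsCert α β cp c0 cm q0 q1 q2) :
    IsCert ![-β 1, -β 2, -β 0, -β 3] ![-α 2, -α 0, -α 1, -α 3] cm c0 cp
      (-(q0 + 2 * q1 + 4 * q2)) (q1 + 4 * q2) (-q2) := fun s => by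
  simp only [Matrix.cons_val]
  linear_combination h (1 - s)

lemma term_eq_zero {a b : Fin 4 → ℂ} {m : ℕ} (l : Fin 4) (k : ℕ) (h : b l + m = -(k : ℂ)) :
    term a b m = 0 := by
  have : ∏ l, Gamma (b l + m) = 0 :=
    Finset.prod_eq_zero (Finset.mem_univ l) (by rw [h, Gamma_neg_nat_eq_zero])
  rw [term, this, div_zero]

/-- Starting `d` steps before `1 - b_i` adds only zeros. -/
lemma hasSum_bilat {a b : Fin 4 → ℂ} {i : Fin 4} {s : ℂ} (d : ℕ) (hs : b i + s + d = 1)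
    (ha : ∀ l (m : ℕ), a l + 1 - b i ≠ -(m : ℂ)) (hab : ∑ l, a l - ∑ l, b l = -2) :
    HasSum (term (fun l => a l + s) fun l => b l + s) (bilat a b i) := by
  rw [← hasSum_nat_add_iff' d, Finset.sum_eq_zero, sub_zero]
  · have h1 : Summable (term (fun l => a l + 1 - b i) fun l => b l + 1 - b i) := by
      refine summable_term ha ?_
      rw [← hab]
      simp only [Fin.sum_univ_four]
      ring
    refine h1.hasSum.congr_fun fun m => ?_
    have h2 : ∀ c : ℂ, c + s + (↑(m + d) : ℂ) = c + 1 - b i + m := fun c => by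
      push_cast
      linear_combination hs
    simp only [term, h2]
  · intro m hm
    have hm' := Finset.mem_range.1 hm
    refine term_eq_zero i (d - 1 - m) ?_
    rw [Nat.cast_sub (by omega), Nat.cast_sub (by omega)]
    push_cast
    linear_combination hs

/-- A certificate expresses the combination of the three summands as a difference. -/
lemma telescope {α β : Fin 4 → ℂ} {cp c0 cm q0 q1 q2 : ℂ} (h : IsCert α β cp c0 cm q0 q1 q2)
    {s : ℂ} (hs : ∀ l (n : ℤ), α l + s ≠ n) (m : ℕ) :
    let a : Fin 4 → ℂ := ![α 0 - 1, α 1 - 1, α 2, α 3]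
    let b : Fin 4 → ℂ := ![β 0 - 1, β 1, β 2, β 3 - 1]
    let G : ℕ → ℂ := fun m => (q0 + q1 * (s + m) + q2 * (s + m) ^ 2) *
      term (fun l => a l + s) (fun l => b l + s) m
    cp * term (fun l => shiftUp 1 α l + s) (fun l => shiftLo 1 β l + s) m
      + c0 * term (fun l => α l + s) (fun l => β l + s) m
      + cm * term (fun l => shiftUp (-1) α l + s) (fun l => shiftLo (-1) β l + s) m
    = G (m + 1) - G m := by
  intro a b G
  have hne : ∀ l (k : ℤ), α l + k + s + m ≠ 0 := fun l k h0 => by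
    refine hs l (-(k + m)) ?_
    push_cast
    linear_combination h0
  have hG : ∀ x y : ℂ, x = y → y ≠ 0 → Gamma (x + 1) = y * Gamma x := fun x y h0 h1 => by
    rw [Gamma_add_one x (h0 ▸ h1), h0]
  -- The lower parameters are treated through the entire function `Γ⁻¹`, whose functional equation
  -- holds at the poles of `Γ` as well.
  have hI : ∀ x : ℂ, (Gamma x)⁻¹ = x * (Gamma (x + 1))⁻¹ :=
    one_div_Gamma_eq_self_mul_one_div_Gamma_add_one
  have n0 := hne 0 (-1)
  have n0' := hne 0 0
  have n1 := hne 1 (-1)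
  have n1' := hne 1 0
  have n2 := hne 2 0
  have n3 := hne 3 0
  set S : ℂ := s + m with hS
  simp only [Int.cast_neg, Int.cast_one, Int.cast_zero, add_zero, ← sub_eq_add_neg, add_assoc,
    ← hS] at n0 n0' n1 n1' n2 n3
  have e0 : Gamma (α 0 + S) = (α 0 - 1 + S) * Gamma (α 0 - 1 + S) := by
    rw [← Gamma_add_one _ n0]; congr 1; ring
  have e0' : Gamma (α 0 + 1 + S) = (α 0 + S) * ((α 0 - 1 + S) * Gamma (α 0 - 1 + S)) := by
    rw [← e0, ← Gamma_add_one _ n0']; congr 1; ring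
  have e1 : Gamma (α 1 + S) = (α 1 - 1 + S) * Gamma (α 1 - 1 + S) := by
    rw [← Gamma_add_one _ n1]; congr 1; ring
  have e1' : Gamma (α 1 + 1 + S) = (α 1 + S) * ((α 1 - 1 + S) * Gamma (α 1 - 1 + S)) := by
    rw [← e1, ← Gamma_add_one _ n1']; congr 1; ring
  have e2 : Gamma (α 2 + (S + 1)) = (α 2 + S) * Gamma (α 2 + S) := by
    rw [← Gamma_add_one _ n2]; congr 1; ring
  have e3 : Gamma (α 3 + (S + 1)) = (α 3 + S) * Gamma (α 3 + S) := by
    rw [← Gamma_add_one _ n3]; congr 1; ring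
  have f0 : (Gamma (β 0 - 1 + S))⁻¹ = (β 0 - 1 + S) * (Gamma (β 0 + S))⁻¹ := by
    rw [hI]; congr 3; ring
  have f3 : (Gamma (β 3 - 1 + S))⁻¹ = (β 3 - 1 + S) * (Gamma (β 3 + S))⁻¹ := by
    rw [hI]; congr 3; ring
  have f1 : (Gamma (β 1 + S))⁻¹ = (β 1 + S) * (Gamma (β 1 + 1 + S))⁻¹ := by
    rw [hI]; congr 3; ring
  have f1' : (Gamma (β 1 - 1 + S))⁻¹ = (β 1 - 1 + S) * ((β 1 + S) * (Gamma (β 1 + 1 + S))⁻¹) := by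
    rw [← f1, hI]; congr 3; ring
  have f2 : (Gamma (β 2 + S))⁻¹ = (β 2 + S) * (Gamma (β 2 + 1 + S))⁻¹ := by
    rw [hI]; congr 3; ring
  have f2' : (Gamma (β 2 - 1 + S))⁻¹ = (β 2 - 1 + S) * ((β 2 + S) * (Gamma (β 2 + 1 + S))⁻¹) := by
    rw [← f2, hI]; congr 3; ring
  have g0 : ∀ c : ℂ, c - 1 + (S + 1) = c + S := fun c => by ring
  have g1 : ∀ c : ℂ, c + (S + 1) = c + 1 + S := fun c => by ring
  clear_value S
  simp only [G, a, b, term, shiftUp, shiftLo, Fin.prod_univ_four, Matrix.cons_val, div_eq_mul_inv,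
    mul_inv, Nat.cast_add, Nat.cast_one, sub_neg_eq_add, add_assoc _ s, ← hS, ← add_assoc s, g0,
    e2, e3]
  simp only [g1 (β 1), g1 (β 2), e0, e0', e1, e1', f0, f1, f1', f2, f2', f3]
  linear_combination (Gamma (α 0 - 1 + S) * Gamma (α 1 - 1 + S) * Gamma (α 2 + S)
    * Gamma (α 3 + S) * ((Gamma (β 0 + S))⁻¹ * (Gamma (β 1 + 1 + S))⁻¹
    * (Gamma (β 2 + 1 + S))⁻¹ * (Gamma (β 3 + S))⁻¹))
    * h S

/-- The boundary term at infinity is the leading coefficient of the certificate. -/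
lemma tendsto_quadratic_mul_term {a b : Fin 4 → ℂ} (hab : ∑ l, a l - ∑ l, b l = -2)
    (q0 q1 q2 s : ℂ) :
    Tendsto (fun m : ℕ => (q0 + q1 * (s + m) + q2 * (s + m) ^ 2) * term a b m) atTop (𝓝 q2) := by
  rw [← tendsto_add_atTop_iff_nat 1]
  have h1 : Tendsto (fun m : ℕ => ((m : ℂ))⁻¹) atTop (𝓝 0) := tendsto_inv_atTop_nhds_zero_nat
  have h2 : Tendsto (fun m : ℕ => q0 * ((m : ℂ))⁻¹ ^ 2 +
      q1 * ((m : ℂ))⁻¹ * (1 + (s + 1) * ((m : ℂ))⁻¹) + q2 * (1 + (s + 1) * ((m : ℂ))⁻¹) ^ 2)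
      atTop (𝓝 (q0 * 0 ^ 2 + q1 * 0 * (1 + (s + 1) * 0) + q2 * (1 + (s + 1) * 0) ^ 2)) := by
    have h3 := (h1.const_mul (s + 1)).const_add 1
    exact ((h1.pow 2).const_mul q0).add ((h1.const_mul q1).mul h3) |>.add ((h3.pow 2).const_mul q2)
  have h4 := h2.mul (tendsto_sq_mul_term hab)
  have h5 : (q0 * 0 ^ 2 + q1 * 0 * (1 + (s + 1) * 0) + q2 * (1 + (s + 1) * 0) ^ 2) * 1 = q2 := by
    ring
  rw [h5] at h4
  refine h4.congr' ?_
  filter_upwards [eventually_gt_atTop 0] with m hm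
  have hm' : (m : ℂ) ≠ 0 := by exact_mod_cast hm.ne'
  push_cast
  field_simp
  ring

/-- The three-term relation satisfied by the sums `bilat`. Its right side does not depend on `i`.
-/
theorem contiguous_relation {α β : Fin 4 → ℂ} {cp c0 cm q0 q1 q2 : ℂ}
    (h : IsCert α β cp c0 cm q0 q1 q2) (hαβ : ∑ l, α l - ∑ l, β l = -2)
    (hgen : ∀ l j (n : ℤ), α l - β j ≠ n) (i : Fin 4) :
    cp * bilat (shiftUp 1 α) (shiftLo 1 β) i + c0 * bilat α β i
      + cm * bilat (shiftUp (-1) α) (shiftLo (-1) β) i = q2 := by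
  obtain ⟨s, hs⟩ : ∃ s, s = -1 - β i := ⟨_, rfl⟩
  have hsum : ∀ ν, ∑ l, shiftUp ν α l - ∑ l, shiftLo ν β l = -2 := fun ν => by
    rw [← hαβ]
    simp only [Fin.sum_univ_four, shiftUp, shiftLo, Matrix.cons_val]
    ring
  have hpole : ∀ (e : ℤ) l (m : ℕ), shiftUp e α l + 1 - shiftLo e β i ≠ -(m : ℂ) := by
    intro e l m h0
    have key : ∃ k : ℤ, shiftUp e α l + 1 - shiftLo e β i = α l - β i + k := by
      fin_cases l <;> fin_cases i <;>
        simp only [shiftUp, shiftLo, Fin.zero_eta, Fin.mk_one, Fin.reduceFinMk, Matrix.cons_val]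
      all_goals first
        | exact ⟨1, by push_cast; ring1⟩
        | exact ⟨1 - e, by push_cast; ring1⟩
        | exact ⟨1 + e, by push_cast; ring1⟩
    obtain ⟨k, hk⟩ := key
    refine hgen l i (-(m + k)) ?_
    push_cast
    linear_combination h0 - hk
  have hS : ∀ e : ℤ, -1 ≤ e → HasSum (term (fun l => shiftUp e α l + s) fun l => shiftLo e β l + s)
      (bilat (shiftUp e α) (shiftLo e β) i) := fun e he => by
    have key : shiftLo e β i = β i ∨ shiftLo e β i = β i - e := by
      fin_cases i <;> simp [shiftLo]
    rcases key with h1 | h1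
    · exact hasSum_bilat 2 (by rw [h1, hs]; push_cast; ring) (hpole e) (hsum e)
    · refine hasSum_bilat (2 + e).toNat ?_ (hpole e) (hsum e)
      have h2 : (((2 + e).toNat : ℤ) : ℂ) = 2 + e := by
        rw [Int.toNat_of_nonneg (by omega)]; push_cast; ring
      rw [h1, hs, ← Int.cast_natCast, h2]
      ring
  have hz : shiftUp 0 α = α ∧ shiftLo 0 β = β := by
    constructor <;> ext l <;> fin_cases l <;> simp [shiftUp, shiftLo]
  have h1 := hS 1 (by norm_num)
  have h2 := hS 0 (by norm_num)
  have h3 := hS (-1) (by norm_num)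
  simp only [Int.cast_one, Int.cast_zero, Int.cast_neg, hz.1, hz.2] at h1 h2 h3
  have h4 := (((h1.mul_left cp).add (h2.mul_left c0)).add (h3.mul_left cm)).tendsto_sum_nat
  have hsα : ∀ l (n : ℤ), α l + s ≠ n := fun l n h0 => by
    refine hgen l i (n + 1) ?_
    push_cast
    linear_combination h0 - hs
  simp only [telescope h hsα] at h4
  refine tendsto_nhds_unique (h4.congr fun M => Finset.sum_range_sub (fun m : ℕ =>
    (q0 + q1 * (s + m) + q2 * (s + m) ^ 2) * term (fun l => ![α 0 - 1, α 1 - 1, α 2, α 3] l + s)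
      (fun l => ![β 0 - 1, β 1, β 2, β 3 - 1] l + s) m) M) ?_
  -- The starting point `s` lies so far to the left that all three sums contain the full range of
  -- nonzero terms and that the boundary term has a denominator factor at a pole.
  have h0 : term (fun l => ![α 0 - 1, α 1 - 1, α 2, α 3] l + s)
      (fun l => ![β 0 - 1, β 1, β 2, β 3 - 1] l + s) 0 = 0 := by
    have key : ![β 0 - 1, β 1, β 2, β 3 - 1] i + s = -(1 : ℕ) ∨
        ![β 0 - 1, β 1, β 2, β 3 - 1] i + s = -(2 : ℕ) := by
      rw [hs]
      fin_cases i <;> simp only [Fin.zero_eta, Fin.mk_one, Fin.reduceFinMk, Matrix.cons_val] <;>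
        push_cast
      · right; ring
      · left; ring
      · left; ring
      · right; ring
    rcases key with h0 | h0
    · exact term_eq_zero i 1 (by simpa using h0)
    · exact term_eq_zero i 2 (by simpa using h0)
  simp only [h0, mul_zero, sub_zero]
  refine tendsto_quadratic_mul_term ?_ _ _ _ _
  simp only [Fin.sum_univ_four, Matrix.cons_val] at hαβ ⊢
  linear_combination hαβ

/-! ### A certificate for each of the four families -/

/-- Existence of a certificate, whatever its polynomial part. -/
def HasCert (α β : Fin 4 → ℂ) (cp c0 cm : ℂ) : Prop := ∃ q0 q1 q2, IsCert α β cp c0 cm q0 q1 q2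

/-- Only `α_l + s` and `β_l + s` enter, so that adding `t` to all parameters translates `s`. -/
lemma HasCert.translate {α β α' β' : Fin 4 → ℂ} {cp c0 cm : ℂ} (h : HasCert α β cp c0 cm) (t : ℂ)
    (hα : ∀ l, α' l = α l + t) (hβ : ∀ l, β' l = β l + t) : HasCert α' β' cp c0 cm := by
  obtain ⟨q0, q1, q2, h⟩ := h
  refine ⟨q0 + q1 * t + q2 * t ^ 2, q1 + 2 * q2 * t, q2, fun s => ?_⟩
  simp only [hα, hβ]
  linear_combination h (s + t)

lemma HasCert.dual {α β : Fin 4 → ℂ} {cp c0 cm : ℂ} (h : HasCert α β cp c0 cm) :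
    HasCert ![-β 1, -β 2, -β 0, -β 3] ![-α 2, -α 0, -α 1, -α 3] cm c0 cp := by
  obtain ⟨q0, q1, q2, h⟩ := h
  exact ⟨_, _, _, h.dual⟩

/-- The explicit certificate. Its polynomial part comes from comparing coefficients of powers of
`s`. -/
lemma hasCert_base (x0 x1 x2 x3 ν : ℂ) :
    HasCert ![1 - x0 / 2, 1 + x0 / 2, (-x1 - x2 - x3) / 2 + ν + 3 / 2,
        (-x1 + x2 + x3) / 2 + ν + 3 / 2]
      ![2 - x0 / 2 + ν, (-x1 - x2 + x3) / 2 + 3 / 2, (-x1 + x2 - x3) / 2 + 3 / 2, 2 + x0 / 2 + ν]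
      (ν * (ν + 1) * ((ν + 1) ^ 2 - x0 ^ 2))
      (ν * (ν + 1 / 2) * (-2 * (ν + 1 / 2) ^ 2 - 1 / 2 + x0 ^ 2 - x1 ^ 2 + x2 ^ 2 + x3 ^ 2))
      ((ν ^ 2 - x2 ^ 2) * (ν ^ 2 - x3 ^ 2)) := by
  refine ⟨ν * (ν + 1) / 4 * ((x2 - x3) ^ 2 - (x1 - 1) ^ 2)
      + x0 ^ 2 / 4 * (x2 * x3 - x1 * ν + ν - ν ^ 2),
    ν * (x2 * x3 + x1 * ν + (x0 ^ 2 + x1 ^ 2 - x2 ^ 2 - x3 ^ 2 - 1) / 2 - ν),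
    -(x2 * x3 + x1 * ν), fun s => ?_⟩
  simp only [Matrix.cons_val]
  ring

/-- The shift `Params.shift` by an arbitrary complex number in place of a natural number. -/
def Params.shiftBy (ν : ℂ) (P : Params) : Params where
  up := ![P.up 0 - ν, P.up 1 - ν, P.up 2, P.up 3]
  lo := ![P.lo 0 - ν, P.lo 1 - ν, P.lo 2]

lemma hasCert_family_zero (A : Fin 4 → ℂ) (n : ℂ) :
    HasCert ((family A 0).shiftBy n).up ((family A 0).shiftBy n).beta
      ((n - 1 / 2) * (n + 1 / 2) * ((n + 1 / 2) ^ 2 - A 0 ^ 2))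
      ((n - 1 / 2) * n * (-2 * n ^ 2 - 1 / 2 + A 0 ^ 2 - A 1 ^ 2 + A 2 ^ 2 + A 3 ^ 2))
      (((n - 1 / 2) ^ 2 - A 2 ^ 2) * ((n - 1 / 2) ^ 2 - A 3 ^ 2)) := by
  have h := (hasCert_base (A 0) (A 1) (A 2) (A 3) (n - 1 / 2)).translate
    (α' := ((family A 0).shiftBy n).up) (β' := ((family A 0).shiftBy n).beta)
    (A 0 / 2 - n - 1 / 2) (fun l => ?_) (fun l => ?_)
  · convert h using 1 <;> ring
  all_goals
    fin_cases l <;> simp [family, Params.shiftBy, Params.beta, sgn] <;> ring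

lemma hasCert_family_one (A : Fin 4 → ℂ) (n : ℂ) :
    HasCert ((family A 1).shiftBy n).up ((family A 1).shiftBy n).beta
      ((n - 1 / 2) * (n + 1 / 2) * ((n + 1 / 2) ^ 2 - A 2 ^ 2))
      ((n - 1 / 2) * n * (-2 * n ^ 2 - 1 / 2 + A 0 ^ 2 - A 1 ^ 2 + A 2 ^ 2 + A 3 ^ 2))
      (((n - 1 / 2) ^ 2 - A 0 ^ 2) * ((n - 1 / 2) ^ 2 - A 3 ^ 2)) := by
  have h := (hasCert_base (A 2) (A 1) (A 0) (A 3) (n - 1 / 2)).translate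
    (α' := ((family A 1).shiftBy n).up) (β' := ((family A 1).shiftBy n).beta)
    (A 2 / 2 - n - 1 / 2) (fun l => ?_) (fun l => ?_)
  · convert h using 1 <;> ring
  all_goals
    fin_cases l <;> simp [family, Params.shiftBy, Params.beta, sgn] <;> ring

lemma hasCert_family_two (A : Fin 4 → ℂ) (n : ℂ) :
    HasCert ((family A 2).shiftBy n).up ((family A 2).shiftBy n).beta
      (((n + 1 / 2) ^ 2 - A 0 ^ 2) * ((n + 1 / 2) ^ 2 - A 2 ^ 2))
      ((n + 1 / 2) * n * (-2 * n ^ 2 - 1 / 2 + A 0 ^ 2 - A 1 ^ 2 + A 2 ^ 2 + A 3 ^ 2))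
      ((n + 1 / 2) * (n - 1 / 2) * ((n - 1 / 2) ^ 2 - A 3 ^ 2)) := by
  have h := (hasCert_base (A 3) (A 1) (-A 2) (-A 0) (-n - 1 / 2)).dual.translate
    (α' := ((family A 2).shiftBy n).up) (β' := ((family A 2).shiftBy n).beta)
    ((A 0 + A 2 - A 1) / 2 - n + 2) (fun l => ?_) (fun l => ?_)
  · convert h using 1 <;> ring
  all_goals
    fin_cases l <;> simp [family, Params.shiftBy, Params.beta, sgn] <;> ring

lemma hasCert_family_three (A : Fin 4 → ℂ) (n : ℂ) :
    HasCert ((family A 3).shiftBy n).up ((family A 3).shiftBy n).beta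
      (((n + 1 / 2) ^ 2 - A 2 ^ 2) * ((n + 1 / 2) ^ 2 - A 3 ^ 2))
      ((n + 1 / 2) * n * (-2 * n ^ 2 - 1 / 2 + A 0 ^ 2 - A 1 ^ 2 + A 2 ^ 2 + A 3 ^ 2))
      ((n + 1 / 2) * (n - 1 / 2) * ((n - 1 / 2) ^ 2 - A 0 ^ 2)) := by
  have h := (hasCert_base (A 0) (A 1) (-A 3) (-A 2) (-n - 1 / 2)).dual.translate
    (α' := ((family A 3).shiftBy n).up) (β' := ((family A 3).shiftBy n).beta)
    ((A 2 + A 3 - A 1) / 2 - n + 2) (fun l => ?_) (fun l => ?_)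
  · convert h using 1 <;> ring
  all_goals
    fin_cases l <;> simp [family, Params.shiftBy, Params.beta, sgn] <;> ring

/-! ### The recurrence for generic parameters -/

/-- The first four of the `y_i` are sums `bilat` of the parameters, the last four are the
negatives of those of the dual parameters. -/
lemma y_eq (i : Fin 8) : (∃ i', ∀ P, y i P = bilat P.up P.beta i') ∨
    ∃ i', ∀ P, y i P = -bilat ![-P.beta 1, -P.beta 2, -P.beta 0, -P.beta 3]
      ![-P.up 2, -P.up 0, -P.up 1, -P.up 3] i' := by
  by_cases hi : i.val < 4
  · refine Or.inl ⟨⟨i, hi⟩, fun P => ?_⟩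
    simp only [y, if_pos hi, f43, one_pow, mul_one, one_mul, bilat]
    congr 1
    ext m
    congr 1 <;> simp [upperRow, lowerRow, hi]
  · have key : ∀ (c : Fin 4) (i' : Fin 4) (P : Params),
        ![-P.up 2, -P.up 0, -P.up 1, -P.up 3] i' = -P.up c →
        i.val - 4 = c →
        y i P = -bilat ![-P.beta 1, -P.beta 2, -P.beta 0, -P.beta 3]
          ![-P.up 2, -P.up 0, -P.up 1, -P.up 3] i' := by
      intro c i' P hc hic
      simp only [y, if_neg hi, f43, one_pow, mul_one, neg_one_mul, bilat]
      congr 2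
      ext m
      have hc' : (⟨i.val - 4, by omega⟩ : Fin 4) = c := Fin.ext hic
      simp only [term, upperRow, lowerRow, dif_neg hi, hc', hc, Fin.prod_univ_four,
        Matrix.cons_val]
      simp only [show ∀ b, -b + 1 - -P.up c = P.up c + 1 - b from fun b => by ring]
      congr 1 <;> ring
    right
    obtain ⟨v, hv⟩ := i
    have : v = 4 ∨ v = 5 ∨ v = 6 ∨ v = 7 := by simp at hi; omega
    rcases this with rfl | rfl | rfl | rfl
    · exact ⟨1, fun P => key 0 1 P (by simp) rfl⟩
    · exact ⟨2, fun P => key 1 2 P (by simp) rfl⟩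
    · exact ⟨0, fun P => key 2 0 P (by simp) rfl⟩
    · exact ⟨3, fun P => key 3 3 P (by simp) rfl⟩

lemma shiftBy_up (ν : ℂ) (P : Params) : (P.shiftBy ν).up = shiftUp ν P.up := rfl

lemma shiftBy_beta (ν : ℂ) (P : Params) : (P.shiftBy ν).beta = shiftLo ν P.beta := by
  ext l; fin_cases l <;> simp [Params.shiftBy, Params.beta, shiftLo]

/-- All eight `y_i` satisfy the same inhomogeneous relation: for the dual parameters the constant
changes sign, and so do the `y_i`. -/
lemma y_relation {P : Params} {cp c0 cm : ℂ} (h : HasCert P.up P.beta cp c0 cm)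
    (hP : ∑ l, P.up l - ∑ l, P.beta l = -2) (hgen : ∀ l j (n : ℤ), P.up l - P.beta j ≠ n) :
    ∃ c, ∀ i, cp * y i (P.shiftBy 1) + c0 * y i P + cm * y i (P.shiftBy (-1)) = c := by
  obtain ⟨q0, q1, q2, h⟩ := h
  refine ⟨q2, fun i => ?_⟩
  rcases y_eq i with ⟨i', hi⟩ | ⟨i', hi⟩
  · simp only [hi, shiftBy_up, shiftBy_beta]
    exact contiguous_relation h hP hgen i'
  · have h1 := contiguous_relation h.dual ?_ ?_ i'
    · have hu : ∀ ν : ℂ, ![-(P.shiftBy ν).beta 1, -(P.shiftBy ν).beta 2, -(P.shiftBy ν).beta 0,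
          -(P.shiftBy ν).beta 3] = shiftUp (-ν) ![-P.beta 1, -P.beta 2, -P.beta 0, -P.beta 3] := by
        intro ν
        ext l
        fin_cases l <;> simp [shiftBy_beta, shiftLo, shiftUp] <;> ring
      have hl : ∀ ν : ℂ, ![-(P.shiftBy ν).up 2, -(P.shiftBy ν).up 0, -(P.shiftBy ν).up 1,
          -(P.shiftBy ν).up 3] = shiftLo (-ν) ![-P.up 2, -P.up 0, -P.up 1, -P.up 3] := by
        intro ν
        ext l
        fin_cases l <;> simp [shiftBy_up, shiftLo, shiftUp] <;> ring
      simp only [hi, hu, hl, neg_neg]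
      linear_combination -h1
    · simp only [Fin.sum_univ_four, Matrix.cons_val] at hP ⊢
      linear_combination hP
    · have hall : ∀ l j, ∃ l' j', ![-P.beta 1, -P.beta 2, -P.beta 0, -P.beta 3] l
          - ![-P.up 2, -P.up 0, -P.up 1, -P.up 3] j = P.up l' - P.beta j' := by
        intro l j
        refine ⟨![2, 0, 1, 3] j, ![1, 2, 0, 3] l, ?_⟩
        fin_cases l <;> fin_cases j <;> simp <;> ring
      intro l j n hn
      obtain ⟨l', j', hl⟩ := hall l j
      exact hgen l' j' n (hl ▸ hn)

lemma family_balanced (A : Fin 4 → ℂ) (k : Fin 4) (ν : ℂ) :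
    ∑ l, ((family A k).shiftBy ν).up l - ∑ l, ((family A k).shiftBy ν).beta l = -2 := by
  fin_cases k <;> simp [Fin.sum_univ_four, family, sgn, Params.beta, Params.shiftBy] <;> ring

/-- `Pm`, `Pz`, `Pp` are the coefficients of `x ^ 0`, `x ^ 1`, `x ^ 2` when `Z(A)`, conjugated by
`x ^ (A₀ - 1/2)` and multiplied by `x`, is written as a polynomial in `x` and the Euler operator.
The argument is the Euler operator, that is `n` on `x ^ n`. -/
noncomputable def Pm (A : Fin 4 → ℂ) (x : ℂ) : ℂ := x * (x - 1) * ((x - 1 / 2) ^ 2 - A 0 ^ 2)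

/-- Coefficient of `x` in `Z(A)`; see `Pm`. -/
noncomputable def Pz (A : Fin 4 → ℂ) (x : ℂ) : ℂ :=
  x ^ 2 * (-2 * x ^ 2 - 1 / 2 + A 0 ^ 2 - A 1 ^ 2 + A 2 ^ 2 + A 3 ^ 2)

/-- Coefficient of `x ^ 2` in `Z(A)`; see `Pm`. -/
noncomputable def Pp (A : Fin 4 → ℂ) (x : ℂ) : ℂ :=
  ((x + 1 / 2) ^ 2 - A 2 ^ 2) * ((x + 1 / 2) ^ 2 - A 3 ^ 2)

lemma natCast_add_one_half_ne_zero (n : ℕ) : (n : ℂ) + 1 / 2 ≠ 0 := by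
  intro h
  have h1 := congrArg Complex.re h
  simp at h1
  have : (0 : ℝ) ≤ n := n.cast_nonneg
  linarith

/-- The quotient of `ratioNum A (n + 1)` and `ratioNum A n`, as a function of `x = n`. -/
noncomputable def stepNum (A : Fin 4 → ℂ) (x : ℂ) : Fin 4 → ℂ
  | 0 => x + 1 / 2
  | 1 => (x + 1 / 2) * ((x + 1 / 2) ^ 2 - A 2 ^ 2)
  | 2 => (x + 1 / 2) ^ 2 - A 2 ^ 2
  | 3 => ((x + 1 / 2) ^ 2 - A 2 ^ 2) * ((x + 1 / 2) ^ 2 - A 3 ^ 2)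

/-- The quotient of `ratioDen A (n + 1)` and `ratioDen A n`, as a function of `x = n`. -/
noncomputable def stepDen (A : Fin 4 → ℂ) (x : ℂ) : Fin 4 → ℂ
  | 0 => x + 1
  | 1 => (x + 1) * ((x + 1 / 2) ^ 2 - A 0 ^ 2)
  | 2 => (x + 1) * (x + 1 / 2)
  | 3 => (x + 1) * (x + 1 / 2) * ((x + 1 / 2) ^ 2 - A 0 ^ 2)

lemma ratioNum_succ (A : Fin 4 → ℂ) (n : ℕ) (k : Fin 4) :
    ratioNum A (n + 1) k = ratioNum A n k * stepNum A n k := by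
  fin_cases k <;> simp only [ratioNum, stepNum, poch, ascPochhammer_succ_eval] <;> ring

lemma ratioDen_succ (A : Fin 4 → ℂ) (n : ℕ) (k : Fin 4) :
    ratioDen A (n + 1) k = ratioDen A n k * stepDen A n k := by
  fin_cases k <;>
    simp [ratioDen, stepDen, poch, ascPochhammer_succ_eval, Nat.factorial_succ] <;> ring

/-- The certificate at `n + 1` of each family, with its coefficients compared with `Pm`, `Pz`,
`Pp`: the Pochhammer ratios are the factors that turn the former into the latter. -/
lemma exists_cert_family (A : Fin 4 → ℂ) (k : Fin 4) (n : ℕ) (hden : ratioDen A (n + 2) k ≠ 0) :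
    ∃ cp c0 cm g, HasCert ((family A k).shiftBy (n + 1)).up ((family A k).shiftBy (n + 1)).beta
      cp c0 cm ∧
      Pm A (n + 2) * (ratioNum A (n + 2) k / ratioDen A (n + 2) k)
        = g * cp * (ratioNum A (n + 1) k / ratioDen A (n + 1) k) ∧
      Pz A (n + 1) = g * c0 ∧
      Pp A n * (ratioNum A n k / ratioDen A n k)
        = g * cm * (ratioNum A (n + 1) k / ratioDen A (n + 1) k) := by
  have hn1 : (n : ℂ) + 1 - 1 / 2 ≠ 0 := by
    rw [show (n : ℂ) + 1 - 1 / 2 = n + 1 / 2 by ring]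
    exact natCast_add_one_half_ne_zero n
  have hn2 : (n : ℂ) + 1 + 1 / 2 ≠ 0 := by simpa using natCast_add_one_half_ne_zero (n + 1)
  rw [ratioDen_succ, mul_ne_zero_iff] at hden
  obtain ⟨hd1, hd2⟩ := hden
  rw [ratioDen_succ, mul_ne_zero_iff] at hd1
  obtain ⟨hd0, hd1⟩ := hd1
  have red : ∀ cp c0 cm x f : ℂ, f ≠ 0 →
      f * Pm A (n + 2) * stepNum A (n + 1 : ℕ) k = x * cp * stepDen A (n + 1 : ℕ) k →
      f * Pz A (n + 1) = x * c0 →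
      f * Pp A n * stepDen A n k = x * cm * stepNum A n k →
      Pm A (n + 2) * (ratioNum A (n + 2) k / ratioDen A (n + 2) k)
        = x / f * cp * (ratioNum A (n + 1) k / ratioDen A (n + 1) k) ∧
      Pz A (n + 1) = x / f * c0 ∧
      Pp A n * (ratioNum A n k / ratioDen A n k)
        = x / f * cm * (ratioNum A (n + 1) k / ratioDen A (n + 1) k) := by
    intro cp c0 cm x f hf h1 h2 h3
    simp only [ratioNum_succ A (n + 1), ratioDen_succ A (n + 1), ratioNum_succ A n,
      ratioDen_succ A n]
    refine ⟨?_, ?_, ?_⟩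
    · field_simp
      linear_combination ratioNum A n k * stepNum A n k * h1
    · field_simp
      linear_combination h2
    · field_simp
      linear_combination ratioNum A n k * h3
  clear hd0 hd1 hd2
  fin_cases k
  · refine ⟨_, _, _, _, hasCert_family_zero A (n + 1), red _ _ _ (n + 1) _ hn1 ?_ ?_ ?_⟩
    all_goals simp [Pm, Pz, Pp, stepNum, stepDen]
    all_goals ring
  · refine ⟨_, _, _, _, hasCert_family_one A (n + 1), red _ _ _ (n + 1) _ hn1 ?_ ?_ ?_⟩
    all_goals simp [Pm, Pz, Pp, stepNum, stepDen]
    all_goals ring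
  · refine ⟨_, _, _, _, hasCert_family_two A (n + 1), red _ _ _ (n + 1) _ hn2 ?_ ?_ ?_⟩
    all_goals simp [Pm, Pz, Pp, stepNum, stepDen]
    all_goals ring
  · refine ⟨_, _, _, _, hasCert_family_three A (n + 1), red _ _ _ (n + 1) _ hn2 ?_ ?_ ?_⟩
    all_goals simp [Pm, Pz, Pp, stepNum, stepDen]
    all_goals ring

lemma W_recurrence_of_generic {A : Fin 4 → ℂ} {k : Fin 4} (i j : Fin 8)
    (hgen : ∀ l l' (m : ℤ), (family A k).up l - (family A k).beta l' ≠ m)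
    (n : ℕ) (hden : ratioDen A (n + 2) k ≠ 0) :
    Pm A (n + 2) * W k i j (n + 2) A + Pz A (n + 1) * W k i j (n + 1) A + Pp A n * W k i j n A
      = 0 := by
  obtain ⟨cp, c0, cm, g, hc, h1, h2, h3⟩ := exists_cert_family A k n hden
  have hgen' : ∀ l l' (m : ℤ), ((family A k).shiftBy (n + 1)).up l
      - ((family A k).shiftBy (n + 1)).beta l' ≠ m := by
    intro l l' m h
    have key : ∃ e : ℤ, ((family A k).shiftBy (n + 1)).up l - ((family A k).shiftBy (n + 1)).beta l'
        = (family A k).up l - (family A k).beta l' + e := by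
      fin_cases l <;> fin_cases l' <;>
        simp only [Params.shiftBy, Params.beta, Fin.zero_eta, Fin.mk_one, Fin.reduceFinMk,
          Matrix.cons_val]
      all_goals first
        | exact ⟨0, by push_cast; ring1⟩
        | exact ⟨n + 1, by push_cast; ring1⟩
        | exact ⟨-(n + 1), by push_cast; ring1⟩
    obtain ⟨e, he⟩ := key
    refine hgen l l' (m - e) ?_
    push_cast
    linear_combination h - he
  obtain ⟨c, hy⟩ := y_relation hc (family_balanced A k _) hgen'
  have e1 : ((family A k).shiftBy (n + 1)).shiftBy 1 = (family A k).shift (n + 2) := by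
    simp only [Params.shiftBy, Params.shift, Matrix.cons_val, Params.mk.injEq]
    constructor <;> congr 1 <;> push_cast <;> ring_nf
  have e2 : (family A k).shiftBy (n + 1) = (family A k).shift (n + 1) := by
    simp only [Params.shiftBy, Params.shift, Nat.cast_add, Nat.cast_one]
  have e3 : ((family A k).shiftBy (n + 1)).shiftBy (-1) = (family A k).shift n := by
    simp only [Params.shiftBy, Params.shift, Matrix.cons_val, Params.mk.injEq]
    constructor <;> congr 1 <;> ring_nf
  simp only [e1, e3] at hy
  simp only [e2] at hy
  simp only [W, ← mul_assoc, h1, h2, h3]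
  linear_combination g * (ratioNum A (n + 1) k / ratioDen A (n + 1) k) * (hy i - hy j)

/-! ### The recurrence for admissible parameters -/

/-- `y_i` divided by the Gamma values at its upper parameters. It is entire along the lines in
parameter space. -/
noncomputable def yReg (i : Fin 8) (P : Params) : ℂ :=
  (if i.val < 4 then 1 else -1) * ∑' m, regTerm (upperRow P i) (lowerRow P i) m

lemma rows_balanced {P : Params} (hP : ∑ l, P.up l - ∑ l, P.beta l = -2) (i : Fin 8) :
    ∑ l, upperRow P i l - ∑ l, lowerRow P i l = -2 := by
  by_cases hi : i.val < 4 <;>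
    simp only [upperRow, lowerRow, hi, dite_true, dite_false, Fin.sum_univ_four] at hP ⊢ <;>
    linear_combination hP

lemma family_rows_balanced (A : Fin 4 → ℂ) (k : Fin 4) (n : ℕ) (i : Fin 8) :
    ∑ l, upperRow ((family A k).shift n) i l - ∑ l, lowerRow ((family A k).shift n) i l = -2 :=
  rows_balanced (family_balanced A k n) i

lemma y_eq_prod_Gamma_mul_yReg {P : Params} {i : Fin 8}
    (hP : ∀ l (m : ℕ), upperRow P i l ≠ -(m : ℂ)) :
    y i P = (∏ l, Gamma (upperRow P i l)) * yReg i P := by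
  simp only [y, yReg, f43, one_pow, mul_one, term_eq_prod_Gamma_mul_regTerm hP, tsum_mul_left]
  ring

/-- The parameters are affine functions of `A`. -/
lemma family_up_line (A v : Fin 4 → ℂ) (k l : Fin 4) (z : ℂ) : (family (A + z • v) k).up l
    = (family A k).up l + z * ((family v k).up l - (family 0 k).up l) := by
  fin_cases k <;> fin_cases l <;> simp [family, sgn] <;> ring

lemma family_beta_line (A v : Fin 4 → ℂ) (k l : Fin 4) (z : ℂ) : (family (A + z • v) k).beta l
    = (family A k).beta l + z * ((family v k).beta l - (family 0 k).beta l) := by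
  fin_cases k <;> fin_cases l <;> simp [family, sgn, Params.beta] <;> ring

lemma shift_up_eq (P : Params) (n : ℕ) (l : Fin 4) :
    (P.shift n).up l = P.up l - n * ![1, 1, 0, 0] l := by
  fin_cases l <;> simp [Params.shift]

lemma shift_beta_eq (P : Params) (n : ℕ) (l : Fin 4) :
    (P.shift n).beta l = P.beta l - n * ![0, 1, 1, 0] l := by
  fin_cases l <;> simp [Params.shift, Params.beta]

lemma differentiable_upperRow_line (A v : Fin 4 → ℂ) (k : Fin 4) (n : ℕ) (i : Fin 8) (l : Fin 4) :
    Differentiable ℂ fun z : ℂ => upperRow ((family (A + z • v) k).shift n) i l := by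
  unfold upperRow
  split_ifs <;> simp only [shift_up_eq, shift_beta_eq, family_up_line, family_beta_line] <;>
    fun_prop

lemma differentiable_lowerRow_line (A v : Fin 4 → ℂ) (k : Fin 4) (n : ℕ) (i : Fin 8) (l : Fin 4) :
    Differentiable ℂ fun z : ℂ => lowerRow ((family (A + z • v) k).shift n) i l := by
  unfold lowerRow
  split_ifs <;> simp only [shift_up_eq, shift_beta_eq, family_up_line, family_beta_line] <;>
    fun_prop

lemma differentiable_yReg_line (A v : Fin 4 → ℂ) (k : Fin 4) (n : ℕ) (i : Fin 8) :
    Differentiable ℂ fun z : ℂ => yReg i ((family (A + z • v) k).shift n) :=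
  (differentiable_tsum_regTerm (differentiable_upperRow_line A v k n i)
    (differentiable_lowerRow_line A v k n i) fun _ => family_rows_balanced _ k n i).const_mul _

/-- At an admissible point `y_i` is the product of the entire function `yReg` and of Gamma values,
which is an identity on a neighbourhood. -/
lemma continuousAt_y_line {A : Fin 4 → ℂ} (v : Fin 4 → ℂ) {k : Fin 4} {n : ℕ} {i : Fin 8}
    (hA : ∀ l (m : ℕ), upperRow ((family A k).shift n) i l ≠ -(m : ℂ)) :
    ContinuousAt (fun z : ℂ => y i ((family (A + z • v) k).shift n)) 0 := by
  have hA' : ∀ l (m : ℕ), upperRow ((family (A + (0 : ℂ) • v) k).shift n) i l ≠ -(m : ℂ) := by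
    simpa using hA
  have h1 : ∀ᶠ z in 𝓝 (0 : ℂ), ∀ l (m : ℕ),
      upperRow ((family (A + z • v) k).shift n) i l ≠ -(m : ℂ) := by
    rw [eventually_all]
    intro l
    have hc : Continuous fun z : ℂ => (Gamma (upperRow ((family (A + z • v) k).shift n) i l))⁻¹ :=
      (differentiable_one_div_Gamma.comp (differentiable_upperRow_line A v k n i l)).continuous
    filter_upwards [hc.continuousAt.eventually_ne (inv_ne_zero (Gamma_ne_zero (hA' l)))]
      with z hz m h
    exact hz (by rw [h, Gamma_neg_nat_eq_zero, inv_zero])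
  refine ContinuousAt.congr ?_ (h1.mono fun z hz => (y_eq_prod_Gamma_mul_yReg hz).symm)
  refine ContinuousAt.mul (tendsto_finsetProd _ fun l _ => ?_)
    (differentiable_yReg_line A v k n i).continuous.continuousAt
  exact ((differentiableAt_Gamma _ (hA' l)).continuousAt).comp
    (f := fun z : ℂ => upperRow ((family (A + z • v) k).shift n) i l)
    (differentiable_upperRow_line A v k n i l).continuous.continuousAt

lemma continuous_poch (n : ℕ) : Continuous fun z => poch z n := Polynomial.continuous _

lemma continuous_ratioNum_line (A v : Fin 4 → ℂ) (n : ℕ) (k : Fin 4) :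
    Continuous fun z : ℂ => ratioNum (A + z • v) n k := by
  have h := continuous_poch n
  fin_cases k <;> simp only [ratioNum, Pi.add_apply, Pi.smul_apply] <;> fun_prop

lemma continuous_ratioDen_line (A v : Fin 4 → ℂ) (n : ℕ) (k : Fin 4) :
    Continuous fun z : ℂ => ratioDen (A + z • v) n k := by
  have h := continuous_poch n
  fin_cases k <;> simp only [ratioDen, Pi.add_apply, Pi.smul_apply] <;> fun_prop

lemma Admissible.continuousAt_W_line {A : Fin 4 → ℂ} {k : Fin 4} {i j : Fin 8}
    (hA : Admissible k i j A) (v : Fin 4 → ℂ) (n : ℕ) :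
    ContinuousAt (fun z : ℂ => W k i j n (A + z • v)) 0 := by
  unfold W
  refine ((continuous_ratioNum_line A v n k).continuousAt.div
    (continuous_ratioDen_line A v n k).continuousAt (by simpa using hA.2 n)).mul
    ((continuousAt_y_line v fun l m => (hA.1 n m l).1).sub
      (continuousAt_y_line v fun l m => (hA.1 n m l).2))

/-- A direction along which no difference `α_l - β_l'` is constant, unless it is constant in `A`.
The entries are powers of `5`, so that no nontrivial combination with coefficients `0, ±1, ±2`
vanishes. -/
def genericDir : Fin 4 → ℂ := ![1, 5, 25, 125]

/-- The differences that do not depend on `A` are all equal to `-1/2`. -/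
lemma family_sub_eq_or (k l l' : Fin 4) :
    ((family genericDir k).up l - (family 0 k).up l)
      - ((family genericDir k).beta l' - (family 0 k).beta l') ≠ 0 ∨
    ∀ A, (family A k).up l - (family A k).beta l' = -1 / 2 := by
  fin_cases k <;> fin_cases l <;> fin_cases l' <;>
    simp only [family, sgn, Params.beta, genericDir, Fin.zero_eta, Fin.mk_one, Fin.reduceFinMk,
      Matrix.cons_val, Pi.zero_apply] <;>
    first
      | exact Or.inr fun A => by ring1
      | (left; norm_num)

lemma ne_intCast_of_eq_neg_half (m : ℤ) : (-1 / 2 : ℂ) ≠ m := by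
  intro h
  have h1 : ((2 * m + 1 : ℤ) : ℂ) = 0 := by push_cast; linear_combination -2 * h
  have h2 : 2 * m + 1 = 0 := by exact_mod_cast h1
  omega

lemma countable_affine_intCast {c d : ℂ} (h : d ≠ 0 ∨ ∀ m : ℤ, c ≠ m) :
    {z : ℂ | ∃ m : ℤ, c + z * d = m}.Countable := by
  rcases eq_or_ne d 0 with rfl | hd
  · convert Set.countable_empty
    ext z
    simpa using h
  · rw [Set.ofPred_exists]
    refine Set.countable_iUnion fun m => Set.Subsingleton.countable fun z hz w hw => ?_
    simp only [Set.mem_ofPred_eq] at hz hw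
    exact mul_right_cancel₀ hd (by linear_combination hz - hw)

/-- On a complex line in the direction `genericDir` integral differences occur only countably
often. -/
lemma countable_nongeneric (A : Fin 4 → ℂ) (k : Fin 4) :
    {z : ℂ | ¬ ∀ l l' (m : ℤ), (family (A + z • genericDir) k).up l
      - (family (A + z • genericDir) k).beta l' ≠ m}.Countable := by
  have h : ∀ l l', ((family genericDir k).up l - (family 0 k).up l)
      - ((family genericDir k).beta l' - (family 0 k).beta l') ≠ 0 ∨
      ∀ m : ℤ, (family A k).up l - (family A k).beta l' ≠ m := fun l l' =>
    (family_sub_eq_or k l l').imp_right fun h m => by rw [h]; exact ne_intCast_of_eq_neg_half m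
  refine (Set.countable_iUnion fun l => Set.countable_iUnion fun l' =>
    countable_affine_intCast (h l l')).mono fun z hz => ?_
  simp only [Set.mem_ofPred_eq, not_forall, not_not, family_up_line, family_beta_line] at hz
  obtain ⟨l, l', m, hm⟩ := hz
  simp only [Set.mem_iUnion, Set.mem_ofPred_eq]
  exact ⟨l, l', m, by linear_combination hm⟩

/-- The recurrence passes from generic to admissible parameters by continuity along `genericDir`.
-/
theorem Admissible.W_recurrence {A : Fin 4 → ℂ} {k : Fin 4} {i j : Fin 8}
    (hA : Admissible k i j A) (n : ℕ) :
    Pm A (n + 2) * W k i j (n + 2) A + Pz A (n + 1) * W k i j (n + 1) A + Pp A n * W k i j n A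
      = 0 := by
  set F : ℂ → ℂ := fun z => Pm (A + z • genericDir) (n + 2) * W k i j (n + 2) (A + z • genericDir)
    + Pz (A + z • genericDir) (n + 1) * W k i j (n + 1) (A + z • genericDir)
    + Pp (A + z • genericDir) n * W k i j n (A + z • genericDir) with hF
  suffices F 0 = 0 by simpa [hF] using this
  have hc : ContinuousAt F 0 := by
    refine ((ContinuousAt.mul ?_ (hA.continuousAt_W_line _ _)).add
      (ContinuousAt.mul ?_ (hA.continuousAt_W_line _ _))).add
      (ContinuousAt.mul ?_ (hA.continuousAt_W_line _ _)) <;>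
    · simp only [Pm, Pz, Pp, Pi.add_apply, Pi.smul_apply]
      fun_prop
  have hd := (countable_nongeneric A k).dense_compl ℂ
  have hne := mem_closure_iff_nhdsWithin_neBot.1 (hd 0)
  refine tendsto_nhds_unique (l := 𝓝[{z : ℂ | ¬ ∀ l l' (m : ℤ), (family (A + z • genericDir) k).up l
      - (family (A + z • genericDir) k).beta l' ≠ m}ᶜ] 0)
    (hc.mono_left nhdsWithin_le_nhds) (tendsto_const_nhds.congr' ?_)
  have hden : ∀ᶠ z in 𝓝 (0 : ℂ), ratioDen (A + z • genericDir) (n + 2) k ≠ 0 :=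
    (continuous_ratioDen_line A _ _ k).continuousAt.eventually_ne (by simpa using hA.2 (n + 2))
  filter_upwards [self_mem_nhdsWithin, hden.filter_mono nhdsWithin_le_nhds] with z hz hz'
  simp only [Set.mem_compl_iff, Set.mem_ofPred_eq, not_not] at hz
  exact (W_recurrence_of_generic i j hz n hz').symm

/-! ### Power series with subexponential coefficients and their branches -/

/-- The power series with coefficients `a` has radius of convergence at least `1`. -/
def Subexp (a : ℕ → ℂ) : Prop := ∀ r : ℝ, 0 < r → r < 1 → Summable fun n => ‖a n‖ * r ^ n

/-- A recurrence whose limit has characteristic polynomial `(t - 1) ^ 2` has solutions of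
subexponential growth. -/
lemma subexp_of_recurrence {w α β : ℕ → ℂ} (hα : Tendsto α atTop (𝓝 2))
    (hβ : Tendsto β atTop (𝓝 1))
    (h : ∀ᶠ n in atTop, w (n + 2) = α n * w (n + 1) - β n * w n) : Subexp w := by
  intro r hr0 hr1
  obtain ⟨δ, hδ⟩ : ∃ δ, δ = (1 - r) / 2 := ⟨_, rfl⟩
  have hδ0 : 0 < δ := by rw [hδ]; linarith
  -- Eventually this norm of `(w n, w (n + 1))` grows by a factor of at most `1 + 2 * δ = 2 - r` per
  -- step, and `r * (2 - r) < 1`.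
  set M : ℕ → ℝ := fun n => δ * ‖w n‖ + ‖w (n + 1) - w n‖ with hM
  have hM0 : ∀ n, 0 ≤ M n := fun n => by positivity
  have hη : 0 < δ ^ 2 / (2 + δ) := by positivity
  have h1 : ∀ᶠ n in atTop, ‖M (n + 1) * r ^ (n + 1)‖ ≤ (r * (2 - r)) * ‖M n * r ^ n‖ := by
    filter_upwards [h, Metric.tendsto_nhds.1 hα _ hη, Metric.tendsto_nhds.1 hβ _ hη] with n h1 h2 h3
    rw [dist_eq_norm] at h2 h3
    rw [Real.norm_of_nonneg (by positivity), Real.norm_of_nonneg (by positivity)]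
    have h4 : ‖w (n + 1)‖ ≤ ‖w n‖ + ‖w (n + 1) - w n‖ := by
      simpa [add_comm] using norm_add_le (w (n + 1) - w n) (w n)
    have h5 : ‖w (n + 2) - w (n + 1)‖ ≤
        ‖w (n + 1) - w n‖ + δ ^ 2 / (2 + δ) * (‖w (n + 1)‖ + ‖w n‖) := by
      have e : w (n + 2) - w (n + 1)
          = (w (n + 1) - w n) + ((α n - 2) * w (n + 1) - (β n - 1) * w n) := by
        rw [h1]; ring
      rw [e]
      refine (norm_add_le _ _).trans (add_le_add le_rfl ((norm_sub_le _ _).trans ?_))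
      rw [norm_mul, norm_mul, mul_add]
      gcongr
    have h6 : M (n + 1) ≤ (2 - r) * M n := by
      have e1 : δ ^ 2 / (2 + δ) * (‖w (n + 1)‖ + ‖w n‖) ≤
          δ ^ 2 / (2 + δ) * ((2 + δ) / δ * M n) := by
        refine mul_le_mul_of_nonneg_left ?_ hη.le
        rw [div_mul_eq_mul_div, le_div_iff₀ hδ0]
        simp only [hM]
        nlinarith [norm_nonneg (w n), norm_nonneg (w (n + 1) - w n)]
      have e2 : δ ^ 2 / (2 + δ) * ((2 + δ) / δ * M n) = δ * M n := by field_simp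
      rw [e2] at e1
      have e3 : 2 - r = 1 + 2 * δ := by rw [hδ]; ring
      rw [e3]
      simp only [hM] at e1 ⊢
      rw [show n + 1 + 1 = n + 2 from rfl]
      nlinarith [norm_nonneg (w n), norm_nonneg (w (n + 1) - w n),
        mul_le_mul_of_nonneg_left h4 hδ0.le]
    calc M (n + 1) * r ^ (n + 1) ≤ ((2 - r) * M n) * r ^ (n + 1) := by gcongr
      _ = _ := by ring
  have h2 : Summable fun n => M n * r ^ n :=
    summable_of_ratio_norm_eventually_le (by nlinarith [sq_pos_of_pos hδ0]) h1
  refine Summable.of_nonneg_of_le (fun n => by positivity) (fun n => ?_) (h2.mul_left δ⁻¹)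
  rw [← mul_assoc]
  gcongr
  rw [inv_mul_eq_div, le_div_iff₀ hδ0, mul_comm]
  exact le_add_of_nonneg_right (norm_nonneg _)

lemma Subexp.const_mul {a : ℕ → ℂ} (ha : Subexp a) (c : ℂ) : Subexp fun n => c * a n :=
  fun r h0 h1 => ((ha r h0 h1).mul_left ‖c‖).congr fun n => by rw [norm_mul, mul_assoc]

lemma Subexp.add {a b : ℕ → ℂ} (ha : Subexp a) (hb : Subexp b) : Subexp fun n => a n + b n :=
  fun r h0 h1 => Summable.of_nonneg_of_le (fun n => by positivity)
    (fun n => by rw [← add_mul]; gcongr; exact norm_add_le _ _) ((ha r h0 h1).add (hb r h0 h1))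

lemma Subexp.natCast_mul {a : ℕ → ℂ} (ha : Subexp a) : Subexp fun n : ℕ => (n : ℂ) * a n := by
  intro r h0 h1
  obtain ⟨s, hs, hs1⟩ := exists_between h1
  have hs0 : 0 < s := h0.trans hs
  have h2 : Tendsto (fun n : ℕ => (n : ℝ) * (r / s) ^ n) atTop (𝓝 0) :=
    tendsto_self_mul_const_pow_of_lt_one (by positivity) ((div_lt_one hs0).2 hs)
  refine Summable.of_norm_bounded_eventually_nat (ha s hs0 hs1) ?_
  filter_upwards [h2.eventually (ge_mem_nhds zero_lt_one)] with n hn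
  rw [Real.norm_of_nonneg (by positivity), norm_mul, Complex.norm_natCast]
  have h3 : r ^ n = (r / s) ^ n * s ^ n := by rw [← mul_pow, div_mul_cancel₀ _ hs0.ne']
  calc (n : ℝ) * ‖a n‖ * r ^ n = (n * (r / s) ^ n) * (‖a n‖ * s ^ n) := by rw [h3]; ring
    _ ≤ 1 * (‖a n‖ * s ^ n) := by gcongr
    _ = _ := one_mul _

lemma Subexp.mul_linear {a : ℕ → ℂ} (ha : Subexp a) (c : ℂ) : Subexp fun n => (c + n) * a n := by
  simpa only [add_mul] using (ha.const_mul c).add ha.natCast_mul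

lemma Subexp.summable {a : ℕ → ℂ} (ha : Subexp a) {x : ℂ} (hx : x ∈ Metric.ball (0 : ℂ) 1) :
    Summable fun n => a n * x ^ n := by
  rw [mem_ball_zero_iff] at hx
  obtain ⟨r, hr, hr1⟩ := exists_between hx
  refine Summable.of_norm_bounded (ha r ((norm_nonneg x).trans_lt hr) hr1) fun n => ?_
  rw [norm_mul, norm_pow]
  gcongr

/-- The sum of the series is differentiable, and the Euler operator acts termwise. -/
lemma Subexp.hasDerivAt {a : ℕ → ℂ} (ha : Subexp a) {x : ℂ} (hx : x ∈ Metric.ball (0 : ℂ) 1) :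
    ∃ d, HasDerivAt (fun z => ∑' n, a n * z ^ n) d x ∧ x * d = ∑' n : ℕ, (n : ℂ) * a n * x ^ n := by
  rw [mem_ball_zero_iff] at hx
  obtain ⟨r, hr, hr1⟩ := exists_between hx
  have hu := ha r ((norm_nonneg x).trans_lt hr) hr1
  have hf : ∀ n : ℕ, DifferentiableOn ℂ (fun z => a n * z ^ n) (Metric.ball (0 : ℂ) r) := fun n =>
    by fun_prop
  have hle : ∀ (n : ℕ) (z : ℂ), z ∈ Metric.ball (0 : ℂ) r → ‖a n * z ^ n‖ ≤ ‖a n‖ * r ^ n :=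
    fun n z hz => by
      rw [mem_ball_zero_iff] at hz
      rw [norm_mul, norm_pow]
      gcongr
  have hxr : x ∈ Metric.ball (0 : ℂ) r := by rwa [mem_ball_zero_iff]
  have h1 := (differentiableOn_tsum_of_summable_norm hu hf Metric.isOpen_ball hle).differentiableAt
    (Metric.isOpen_ball.mem_nhds hxr)
  refine ⟨_, h1.hasDerivAt, ?_⟩
  have h2 := (hasSum_deriv_of_summable_norm hu hf Metric.isOpen_ball hle hxr).mul_left x
  rw [← h2.tsum_eq]
  congr 1
  ext n
  simp only [deriv_const_mul_field', deriv_pow_field]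
  rcases n with _ | n
  · simp
  · simp [pow_succ]
    ring

lemma Subexp.differentiableOn {a : ℕ → ℂ} (ha : Subexp a) :
    DifferentiableOn ℂ (fun z => ∑' n, a n * z ^ n) (Metric.ball 0 1) := fun x hx => by
  obtain ⟨d, hd, -⟩ := ha.hasDerivAt hx
  exact hd.differentiableAt.differentiableWithinAt

/-- The branch of `x ^ ρ * ∑ a n * x ^ n` given by the branch `L` of the logarithm. -/
noncomputable def branchSeries (L : ℂ → ℂ) (ρ : ℂ) (a : ℕ → ℂ) (x : ℂ) : ℂ :=
  exp (ρ * L x) * ∑' n, a n * x ^ n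

lemma hasDerivAt_branchSeries {U : Set ℂ} {L : ℂ → ℂ} (hU : IsOpen U)
    (hU1 : U ⊆ Metric.ball 0 1 \ {0}) (hL : DifferentiableOn ℂ L U)
    (hexp : ∀ x ∈ U, exp (L x) = x) {a : ℕ → ℂ} (ha : Subexp a) (ρ : ℂ) {x : ℂ} (hx : x ∈ U) :
    HasDerivAt (branchSeries L ρ a) (branchSeries L (ρ - 1) (fun n => (ρ + n) * a n) x) x := by
  have hx1 := (hU1 hx).1
  have hx0 : x ≠ 0 := (hU1 hx).2
  have hLd := ((hL x hx).differentiableAt (hU.mem_nhds hx)).hasDerivAt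
  have hL' : deriv L x = x⁻¹ := by
    have h1 := hLd.cexp
    have h2 : HasDerivAt (fun z => exp (L z)) 1 x :=
      (hasDerivAt_id x).congr_of_eventuallyEq (by
        filter_upwards [hU.mem_nhds hx] with z hz using hexp z hz)
    have h3 := h1.unique h2
    rw [hexp x hx] at h3
    exact eq_inv_of_mul_eq_one_right h3
  rw [hL'] at hLd
  obtain ⟨d, hd, hxd⟩ := ha.hasDerivAt hx1
  refine ((hLd.const_mul ρ).cexp.mul hd).congr_deriv ?_
  have hE : exp ((ρ - 1) * L x) = exp (ρ * L x) * x⁻¹ := by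
    rw [sub_mul, one_mul, exp_sub, hexp x hx, div_eq_mul_inv]
  have hs : ∑' n : ℕ, (ρ + n) * a n * x ^ n = ρ * ∑' n, a n * x ^ n + x * d := by
    rw [hxd, ← tsum_mul_left, ← (((ha.summable hx1).mul_left ρ).tsum_add
      (ha.natCast_mul.summable hx1))]
    congr 1
    ext n
    ring
  rw [branchSeries, hE, hs]
  field_simp

lemma iteratedDeriv_branchSeries {U : Set ℂ} {L : ℂ → ℂ} (hU : IsOpen U)
    (hU1 : U ⊆ Metric.ball 0 1 \ {0}) (hL : DifferentiableOn ℂ L U)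
    (hexp : ∀ x ∈ U, exp (L x) = x) {a : ℕ → ℂ} (ha : Subexp a) (ρ : ℂ) (m : ℕ) :
    (Subexp fun n => (descPochhammer ℂ m).eval (ρ + n) * a n) ∧
    ∀ x ∈ U, iteratedDeriv m (branchSeries L ρ a) x
      = branchSeries L (ρ - m) (fun n => (descPochhammer ℂ m).eval (ρ + n) * a n) x := by
  induction m with
  | zero => simpa using ha
  | succ m ih =>
    obtain ⟨ih1, ih2⟩ := ih
    have e : (fun n : ℕ => (descPochhammer ℂ (m + 1)).eval (ρ + n) * a n)
        = fun n : ℕ => (ρ - m + n) * ((descPochhammer ℂ m).eval (ρ + n) * a n) := by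
      ext n
      rw [descPochhammer_succ_eval]
      ring
    rw [e]
    refine ⟨ih1.mul_linear _, fun x hx => ?_⟩
    rw [iteratedDeriv_succ]
    have h1 : iteratedDeriv m (branchSeries L ρ a) =ᶠ[𝓝 x]
        branchSeries L (ρ - m) (fun n => (descPochhammer ℂ m).eval (ρ + n) * a n) := by
      filter_upwards [hU.mem_nhds hx] with z hz using ih2 z hz
    rw [h1.deriv_eq, (hasDerivAt_branchSeries hU hU1 hL hexp ih1 _ hx).deriv]
    push_cast
    rw [sub_sub]

/-! ### From the recurrence to the differential equation -/

lemma Subexp.Pm_mul {w : ℕ → ℂ} (hw : Subexp w) (A : Fin 4 → ℂ) :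
    Subexp fun n : ℕ => Pm A n * w n := by
  convert (((hw.mul_linear (-1 / 2 - A 0)).mul_linear (-1 / 2 + A 0)).mul_linear (-1)).mul_linear 0
    using 2 with n
  rw [Pm]
  ring

lemma Subexp.Pp_mul {w : ℕ → ℂ} (hw : Subexp w) (A : Fin 4 → ℂ) :
    Subexp fun n : ℕ => Pp A n * w n := by
  convert (((hw.mul_linear (1 / 2 - A 2)).mul_linear (1 / 2 + A 2)).mul_linear
    (1 / 2 - A 3)).mul_linear (1 / 2 + A 3) using 2 with n
  rw [Pp]
  ring

lemma Subexp.Pz_mul {w : ℕ → ℂ} (hw : Subexp w) (A : Fin 4 → ℂ) :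
    Subexp fun n : ℕ => Pz A n * w n := by
  have h2 := (hw.mul_linear 0).mul_linear 0
  convert (h2.const_mul (-1 / 2 + A 0 ^ 2 - A 1 ^ 2 + A 2 ^ 2 + A 3 ^ 2)).add
    (((h2.mul_linear 0).mul_linear 0).const_mul (-2)) using 2 with n
  rw [Pz]
  ring

/-- The terms of degree `0` and `1`, for which the recurrence says nothing, vanish because
`Pm A 0`, `Pm A 1` and `Pz A 0` do. -/
lemma tsum_eq_zero_of_recurrence {A : Fin 4 → ℂ} {w : ℕ → ℂ} (hw : Subexp w)
    (hrec : ∀ n : ℕ, Pm A (n + 2) * w (n + 2) + Pz A (n + 1) * w (n + 1) + Pp A n * w n = 0)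
    {x : ℂ} (hx : x ∈ Metric.ball (0 : ℂ) 1) :
    ∑' n : ℕ, Pm A n * w n * x ^ n + x * ∑' n : ℕ, Pz A n * w n * x ^ n
      + x ^ 2 * ∑' n : ℕ, Pp A n * w n * x ^ n = 0 := by
  have h1 := ((hw.Pm_mul A).summable hx).hasSum
  have h2 := ((hw.Pz_mul A).summable hx).hasSum
  have h3 := ((hw.Pp_mul A).summable hx).hasSum
  rw [← hasSum_nat_add_iff' 2] at h1
  rw [← hasSum_nat_add_iff' 1] at h2
  have h4 := (h1.add (h2.mul_left x)).add (h3.mul_left (x ^ 2))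
  have h5 : ∑ n ∈ Finset.range 2, Pm A n * w n * x ^ n = 0 := by
    simp [Finset.sum_range_succ, Pm]
  have h6 : ∑ n ∈ Finset.range 1, Pz A n * w n * x ^ n = 0 := by simp [Pz]
  rw [h5, h6, sub_zero, sub_zero] at h4
  refine h4.unique ?_
  convert hasSum_zero using 2 with n
  push_cast
  linear_combination x ^ (n + 2) * hrec n

/-- After division by `x ^ (ρ - 4)`, where `ρ = A₀ - 1/2`, all the derivatives are power series,
and `Z(A)` becomes `tsum_eq_zero_of_recurrence`, coefficient by coefficient. -/
theorem solves_of_recurrence {A : Fin 4 → ℂ} {w : ℕ → ℂ} (hw : Subexp w)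
    (hrec : ∀ n : ℕ, Pm A (n + 2) * w (n + 2) + Pz A (n + 1) * w (n + 1) + Pp A n * w n = 0)
    {U : Set ℂ} {L : ℂ → ℂ} (hU : IsOpen U) (hU1 : U ⊆ Metric.ball 0 1 \ {0})
    (hL : DifferentiableOn ℂ L U) (hexp : ∀ x ∈ U, exp (L x) = x) :
    Solves A U (branchSeries L (A 0 - 1 / 2) w) := by
  refine ⟨fun x hx => (hasDerivAt_branchSeries hU hU1 hL hexp hw _
    hx).differentiableAt.differentiableWithinAt, fun x hx => ?_⟩
  have hx1 := (hU1 hx).1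
  obtain ⟨ρ, hρ⟩ : ∃ ρ, ρ = A 0 - 1 / 2 := ⟨_, rfl⟩
  rw [← hρ]
  have hI := iteratedDeriv_branchSeries hU hU1 hL hexp hw ρ
  have hpow : ∀ m : ℕ, m ≤ 4 → exp ((ρ - m) * L x) = exp ((ρ - 4) * L x) * x ^ (4 - m) := by
    intro m hm
    have h1 := exp_nat_mul (L x) (4 - m)
    rw [hexp x hx] at h1
    rw [← h1, ← exp_add, Nat.cast_sub hm]
    congr 1
    push_cast
    ring
  have hE0 : branchSeries L ρ w x = exp ((ρ - 4) * L x) * x ^ 4 * ∑' n, w n * x ^ n := by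
    have := hpow 0 (by norm_num)
    rw [Nat.cast_zero, sub_zero] at this
    rw [branchSeries, this]
  have hE : ∀ m : ℕ, m ≤ 4 → iteratedDeriv m (branchSeries L ρ w) x
      = exp ((ρ - 4) * L x) * x ^ (4 - m)
        * ∑' n : ℕ, (descPochhammer ℂ m).eval (ρ + n) * w n * x ^ n := fun m hm => by
    rw [(hI m).2 x hx, branchSeries, hpow m hm]
  rw [hE 4 le_rfl, hE 3 (by norm_num), hE 2 (by norm_num), hE 1 (by norm_num), hE0]
  have hs := fun m => ((hI m).1.summable hx1).hasSum
  have h0 := (hw.summable hx1).hasSum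
  have hsum := (((((hs 4).mul_left ((x - 1) ^ 2)).add
    ((hs 3).mul_left (-2 * (x - 1) * (2 * A 0 * x - 2 * A 0 - 5 * x + 3)))).add
    ((hs 2).mul_left ((6 * A 0 ^ 2 - A 2 ^ 2 - A 3 ^ 2 - 24 * A 0 + 25) * x ^ 2
    + (-11 * A 0 ^ 2 - A 1 ^ 2 + A 2 ^ 2 + A 3 ^ 2 + 36 * A 0 - 59 / 2) * x
    + (10 * A 0 - 9) * (2 * A 0 - 3) / 4))).add
    ((hs 1).mul_left (p3 A x))).add (h0.mul_left (x * p4 A x))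
  have hsum' := ((((hw.Pm_mul A).summable hx1).hasSum).add
    ((((hw.Pz_mul A).summable hx1).hasSum).mul_left x)).add
    ((((hw.Pp_mul A).summable hx1).hasSum).mul_left (x ^ 2))
  rw [tsum_eq_zero_of_recurrence hw hrec hx1] at hsum'
  have hd : ∀ t : ℂ, (descPochhammer ℂ 4).eval t = t * (t - 1) * (t - 2) * (t - 3) ∧
      (descPochhammer ℂ 3).eval t = t * (t - 1) * (t - 2) ∧
      (descPochhammer ℂ 2).eval t = t * (t - 1) ∧ (descPochhammer ℂ 1).eval t = t := by
    intro t
    simp [descPochhammer_succ_eval, show (4 : ℕ) = 3 + 1 from rfl, show (3 : ℕ) = 2 + 1 from rfl,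
      show (2 : ℕ) = 1 + 1 from rfl]
  have h7 := hsum.unique (hsum'.congr_fun fun n => ?_)
  · simp only [p0, p1, p2]
    linear_combination exp ((ρ - 4) * L x) * x ^ 3 * h7
  · simp only [(hd _).1, (hd _).2.1, (hd _).2.2.1, (hd _).2.2.2, Pm, Pz, Pp, p3, p4, hρ]
    ring

lemma subexp_of_Pm_recurrence {A : Fin 4 → ℂ} {w : ℕ → ℂ}
    (hrec : ∀ n : ℕ, Pm A (n + 2) * w (n + 2) + Pz A (n + 1) * w (n + 1) + Pp A n * w n = 0) :
    Subexp w := by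
  -- With `t = 1 / n`, the coefficients divided by `n ^ 4` are polynomials in `t`.
  have lim : ∀ g : ℂ → ℂ, Continuous g → Tendsto (fun n : ℕ => g ((n : ℂ))⁻¹) atTop (𝓝 (g 0)) :=
    fun g hg => (hg.tendsto 0).comp tendsto_inv_atTop_nhds_zero_nat
  obtain ⟨gm, hgm⟩ : ∃ g : ℂ → ℂ, g = fun t =>
    (1 + 2 * t) * (1 + t) * ((1 + 3 / 2 * t) ^ 2 - (A 0 * t) ^ 2) := ⟨_, rfl⟩
  obtain ⟨gz, hgz⟩ : ∃ g : ℂ → ℂ, g = fun t => (1 + t) ^ 2 * (-2 * (1 + t) ^ 2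
    + (-1 / 2 + A 0 ^ 2 - A 1 ^ 2 + A 2 ^ 2 + A 3 ^ 2) * t ^ 2) := ⟨_, rfl⟩
  obtain ⟨gp, hgp⟩ : ∃ g : ℂ → ℂ, g = fun t =>
    ((1 + 1 / 2 * t) ^ 2 - (A 2 * t) ^ 2) * ((1 + 1 / 2 * t) ^ 2 - (A 3 * t) ^ 2) := ⟨_, rfl⟩
  have hm := lim gm (by rw [hgm]; fun_prop)
  have hz := lim gz (by rw [hgz]; fun_prop)
  have hp := lim gp (by rw [hgp]; fun_prop)
  rw [show gm 0 = 1 by simp [hgm]] at hm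
  rw [show gz 0 = -2 by simp [hgz]] at hz
  rw [show gp 0 = 1 by simp [hgp]] at hp
  have h1 : Tendsto (fun n : ℕ => -(gz (n : ℂ)⁻¹ / gm (n : ℂ)⁻¹)) atTop (𝓝 2) := by
    simpa using (hz.div hm one_ne_zero).neg
  have h2 : Tendsto (fun n : ℕ => gp (n : ℂ)⁻¹ / gm (n : ℂ)⁻¹) atTop (𝓝 1) := by
    simpa [Pi.div_def] using hp.div hm one_ne_zero
  refine subexp_of_recurrence h1 h2 ?_
  filter_upwards [hm.eventually_ne one_ne_zero, eventually_gt_atTop 0] with n hn hn0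
  have hn0' : (n : ℂ) ≠ 0 := by exact_mod_cast hn0.ne'
  have h3 := hrec n
  have e1 : Pm A (n + 2) = n ^ 4 * gm (n : ℂ)⁻¹ := by
    rw [Pm, hgm]; field_simp; ring
  have e2 : Pz A (n + 1) = n ^ 4 * gz (n : ℂ)⁻¹ := by
    rw [Pz, hgz]; field_simp; ring
  have e3 : Pp A n = n ^ 4 * gp (n : ℂ)⁻¹ := by
    rw [Pp, hgp]; field_simp
  rw [e1, e2, e3] at h3
  have h4 : gm (n : ℂ)⁻¹ * w (n + 2) + gz (n : ℂ)⁻¹ * w (n + 1) + gp (n : ℂ)⁻¹ * w n = 0 := by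
    refine (mul_eq_zero.1 (?_ : (n : ℂ) ^ 4 * _ = 0)).resolve_left (pow_ne_zero _ hn0')
    linear_combination h3
  generalize gm (n : ℂ)⁻¹ = a at hn h4 ⊢
  generalize gz (n : ℂ)⁻¹ = b at h4 ⊢
  generalize gp (n : ℂ)⁻¹ = c at h4 ⊢
  field_simp
  linear_combination h4

/-! ### Parameters where two of the functions `y_i` differ -/

/-- The array of differences `α_a - β_b` of the `k`-th family. These numbers plus `1` are the
upper parameters of the `y_i`: the four entries of column `i` for `i < 4`, of row `i - 4` for
`i ≥ 4`. -/
noncomputable def diff (A : Fin 4 → ℂ) (k a b : Fin 4) : ℂ :=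
  (family A k).up a - (family A k).beta b

/-- The entry `(p, q)` of the array is `-1`, no other entry is integral, and differences of two
rows or of two columns are nonintegral where row `p` or column `q` is involved. The index `c` in
the last two conditions is immaterial for an array of the form `α_a - β_b`. -/
structure IsIsolated (D : Fin 4 → Fin 4 → ℂ) (p q : Fin 4) : Prop where
  eq_neg_one : D p q = -1
  ne_int : ∀ a b, a ≠ p ∨ b ≠ q → ∀ m : ℤ, D a b ≠ m
  row_ne_int : ∀ a, a ≠ p → ∀ c, ∀ m : ℤ, D p c - D a c ≠ m
  col_ne_int : ∀ b, b ≠ q → ∀ c, ∀ m : ℤ, D c q - D c b ≠ m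

lemma family_zero_up_im (A : Fin 4 → ℂ) (a : Fin 4) : ((family A 0).up a).im
    = ![0, (A 0).im, ((A 0).im - (A 1).im - (A 2).im - (A 3).im) / 2,
        ((A 0).im - (A 1).im + (A 2).im + (A 3).im) / 2] a := by
  fin_cases a <;> simp [family, sgn] <;> ring

lemma family_zero_beta_im (A : Fin 4 → ℂ) (b : Fin 4) : ((family A 0).beta b).im
    = ![0, ((A 0).im - (A 1).im - (A 2).im + (A 3).im) / 2,
        ((A 0).im - (A 1).im + (A 2).im - (A 3).im) / 2, (A 0).im] b := by
  fin_cases b <;> simp [family, sgn, Params.beta] <;> ring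

/-- A nontrivial combination of the imaginary parts `1, 2, 4, -7` with coefficients `0, ±1`
vanishes only for `1 + 2 + 4 - 7 = 0` and its negative. The signs are chosen such that this
combination occurs in the entry `(p, q)`; the other entries and the relevant differences of rows
and columns are nonreal or equal to `-1/2`. The list consists of the entries that involve all four
`A_l`. -/
lemma isIsolated_witness {p q : Fin 4} (e0 e1 e2 e3 : ℤ)
    (h : (p, q, e0, e1, e2, e3) ∈ [(0, 1, -1, 1, 1, -1), (0, 2, -1, 1, -1, 1), (1, 1, 1, 1, 1, -1),
      (1, 2, 1, 1, -1, 1), (2, 0, 1, -1, -1, -1), (2, 3, -1, -1, -1, -1), (3, 0, 1, -1, 1, 1),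
      (3, 3, -1, -1, 1, 1)]) :
    IsIsolated (diff ![e0 * (-1 + I), e1 * (2 * I), e2 * (4 * I), e3 * (-7 * I)] 0) p q := by
  have im_ne : ∀ x : ℂ, x.im ≠ 0 → ∀ m : ℤ, x ≠ m := fun x hx m h => hx (by simp [h])
  have half : ∀ x : ℂ, x = -1 / 2 → ∀ m : ℤ, x ≠ m := fun x hx m h =>
    ne_intCast_of_eq_neg_half m (hx ▸ h)
  have hrow : ∀ A a b c, diff A 0 a c - diff A 0 b c = (family A 0).up a - (family A 0).up b :=
    fun A a b c => by simp only [diff]; ring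
  have hcol : ∀ A a b c, diff A 0 c a - diff A 0 c b = (family A 0).beta b - (family A 0).beta a :=
    fun A a b c => by simp only [diff]; ring
  generalize hA : ![(e0 : ℂ) * (-1 + I), e1 * (2 * I), e2 * (4 * I), e3 * (-7 * I)] = A
  have h0 : A 0 = e0 * (-1 + I) := by rw [← hA]; rfl
  have h1 : A 1 = e1 * (2 * I) := by rw [← hA]; rfl
  have h2 : A 2 = e2 * (4 * I) := by rw [← hA]; rfl
  have h3 : A 3 = e3 * (-7 * I) := by rw [← hA]; rfl
  have i0 : (A 0).im = e0 := by simp [h0]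
  have i1 : (A 1).im = 2 * e1 := by simp [h1, mul_comm]
  have i2 : (A 2).im = 4 * e2 := by simp [h2, mul_comm]
  have i3 : (A 3).im = -7 * e3 := by simp [h3, mul_comm]
  clear hA
  simp only [List.mem_cons, Prod.mk.injEq, List.not_mem_nil, or_false] at h
  rcases h with h | h | h | h | h | h | h | h <;> obtain ⟨rfl, rfl, rfl, rfl, rfl, rfl⟩ := h <;>
    push_cast at h0 h1 h2 h3 i0 i1 i2 i3 <;>
    refine ⟨?_, fun a b hab => ?_, fun a ha c => hrow A _ a c ▸ ?_,
      fun b hb c => hcol A _ b c ▸ ?_⟩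
  all_goals first
    | (simp only [diff, family, Params.beta, sgn, Matrix.cons_val, h0, h1, h2, h3]; ring1)
    | skip
  all_goals first
    | (fin_cases a <;> fin_cases b)
    | fin_cases a
    | fin_cases b
  all_goals first
    | (exfalso; simp at hab; done)
    | (exfalso; simp at ha; done)
    | (exfalso; simp at hb; done)
    | (refine im_ne _ ?_
       simp only [diff, sub_im, family_zero_up_im, family_zero_beta_im, i0, i1, i2, i3,
         Fin.zero_eta, Fin.mk_one, Fin.reduceFinMk, Matrix.cons_val]
       norm_num
       done)
    | (refine half _ ?_
       simp only [diff, family, Params.beta, sgn, Matrix.cons_val, Fin.zero_eta, Fin.mk_one,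
         Fin.reduceFinMk, h0, h1, h2, h3]
       ring1)

/-- Isolated entries are preserved when rows and columns are interchanged and permuted. -/
lemma IsIsolated.transpose {D D' : Fin 4 → Fin 4 → ℂ} {σ τ : Fin 4 → Fin 4}
    (hσ : Function.Injective σ) (hτ : Function.Injective τ) {p q : Fin 4}
    (h : IsIsolated D (τ q) (σ p)) (hD : ∀ a b, D' a b = D (τ b) (σ a)) : IsIsolated D' p q where
  eq_neg_one := by rw [hD, h.eq_neg_one]
  ne_int a b hab := by
    rw [hD]
    exact h.ne_int _ _ (hab.symm.imp hτ.ne hσ.ne)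
  row_ne_int a ha c := by
    rw [hD, hD]
    exact h.col_ne_int _ (hσ.ne ha) _
  col_ne_int b hb c := by
    rw [hD, hD]
    exact h.row_ne_int _ (hτ.ne hb) _

lemma exists_isIsolated_zero (p q : Fin 4) (hpq : p.val < 2 ↔ (q.val = 1 ∨ q.val = 2)) :
    ∃ B, IsIsolated (diff B 0) p q := by
  fin_cases p <;> fin_cases q <;> first
    | exact absurd hpq (by decide)
    | exact ⟨_, isIsolated_witness (-1) 1 1 (-1) (by decide)⟩
    | exact ⟨_, isIsolated_witness (-1) 1 (-1) 1 (by decide)⟩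
    | exact ⟨_, isIsolated_witness 1 1 1 (-1) (by decide)⟩
    | exact ⟨_, isIsolated_witness 1 1 (-1) 1 (by decide)⟩
    | exact ⟨_, isIsolated_witness 1 (-1) (-1) (-1) (by decide)⟩
    | exact ⟨_, isIsolated_witness (-1) (-1) (-1) (-1) (by decide)⟩
    | exact ⟨_, isIsolated_witness 1 (-1) 1 1 (by decide)⟩
    | exact ⟨_, isIsolated_witness (-1) (-1) 1 1 (by decide)⟩

/-- The second family is the first one with `A₀` and `A₂` interchanged. -/
lemma diff_one (B : Fin 4 → ℂ) : diff ![B 2, B 1, B 0, B 3] 1 = diff B 0 := by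
  ext a b
  fin_cases a <;> fin_cases b <;> simp [diff, family, sgn, Params.beta] <;> ring

/-- The third family is dual to the first one, up to a linear substitution of `A`. -/
lemma diff_two (B : Fin 4 → ℂ) (a b : Fin 4) :
    diff ![-B 3, B 1, -B 2, B 0] 2 a b = diff B 0 (![2, 0, 1, 3] b) (![1, 2, 0, 3] a) := by
  fin_cases a <;> fin_cases b <;> simp [diff, family, sgn, Params.beta] <;> ring

/-- The fourth family is dual to the first one, up to a linear substitution of `A`. -/
lemma diff_three (B : Fin 4 → ℂ) (a b : Fin 4) :
    diff ![B 0, B 1, -B 3, -B 2] 3 a b = diff B 0 (![2, 0, 1, 3] b) (![1, 2, 0, 3] a) := by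
  fin_cases a <;> fin_cases b <;> simp [diff, family, sgn, Params.beta] <;> ring

/-- The condition on `(p, q)` selects the entries that involve all four `A_l`. The others are
constant or involve a single one. -/
lemma exists_isIsolated (k p q : Fin 4) (hpq : p.val < 2 ↔ (q.val = 1 ∨ q.val = 2)) :
    ∃ B, IsIsolated (diff B k) p q := by
  have hσ : Function.Injective (![1, 2, 0, 3] : Fin 4 → Fin 4) := by decide
  have hτ : Function.Injective (![2, 0, 1, 3] : Fin 4 → Fin 4) := by decide
  have hpq' : ((![2, 0, 1, 3] : Fin 4 → Fin 4) q).val < 2 ↔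
      (((![1, 2, 0, 3] : Fin 4 → Fin 4) p).val = 1 ∨
        ((![1, 2, 0, 3] : Fin 4 → Fin 4) p).val = 2) := by
    revert p q; decide
  obtain ⟨B, hB⟩ := exists_isIsolated_zero p q hpq
  obtain ⟨C, hC⟩ := exists_isIsolated_zero _ _ hpq'
  fin_cases k
  · exact ⟨B, hB⟩
  · exact ⟨_, diff_one B ▸ hB⟩
  · exact ⟨_, hC.transpose hσ hτ (diff_two C)⟩
  · exact ⟨_, hC.transpose hσ hτ (diff_three C)⟩

/-- The entry `(a, b)` of the array of differences occurs in `y_i`: it lies in column `i` or in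
row `i - 4`. -/
def OnLine (i : Fin 8) (a b : Fin 4) : Prop := i.val = b.val ∨ i.val = 4 + a.val

instance (i : Fin 8) (a b : Fin 4) : Decidable (OnLine i a b) := by unfold OnLine; infer_instance

/-- Some entry that involves all four `A_l` occurs in `y_i` and not in `y_j`. -/
lemma exists_onLine_of_ne : ∀ i j : Fin 8, i ≠ j → ∃ p q : Fin 4,
    (p.val < 2 ↔ (q.val = 1 ∨ q.val = 2)) ∧ OnLine i p q ∧ ¬ OnLine j p q := by
  decide

lemma exists_upperRow_eq (i : Fin 8) (l : Fin 4) :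
    ∃ a b, OnLine i a b ∧ ∀ P, upperRow P i l = P.up a - P.beta b + 1 := by
  by_cases hi : i.val < 4
  · exact ⟨l, ⟨i, hi⟩, Or.inl rfl, fun P => by rw [upperRow, dif_pos hi]; ring⟩
  · exact ⟨⟨i.val - 4, by omega⟩, l, Or.inr (by simp; omega),
      fun P => by rw [upperRow, dif_neg hi]; ring⟩

lemma OnLine.exists_upperRow_eq {i : Fin 8} {a b : Fin 4} (h : OnLine i a b) :
    ∃ l, ∀ P, upperRow P i l = P.up a - P.beta b + 1 := by
  rcases h with h | h
  · have hi : i.val < 4 := by omega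
    have hb : (⟨i.val, hi⟩ : Fin 4) = b := Fin.ext h
    exact ⟨a, fun P => by rw [upperRow, dif_pos hi, hb]; ring⟩
  · have hi : ¬ i.val < 4 := by omega
    have ha : (⟨i.val - 4, by omega⟩ : Fin 4) = a := Fin.ext (by simp; omega)
    exact ⟨b, fun P => by rw [upperRow, dif_neg hi, ha]; ring⟩

lemma IsIsolated.lowerRow_ne {k p q : Fin 4} {B : Fin 4 → ℂ} (h : IsIsolated (diff B k) p q)
    {i : Fin 8} (hi : OnLine i p q) (l : Fin 4) (m : ℕ) :
    lowerRow (family B k) i l ≠ -(m : ℂ) := by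
  have h1 : (1 : ℂ) ≠ -(m : ℂ) := fun h0 => by
    have h2 : ((1 + m : ℕ) : ℂ) = 0 := by push_cast; linear_combination h0
    have h3 : 1 + m = 0 := by exact_mod_cast h2
    omega
  intro h0
  rcases hi with hi | hi
  · have hi' : i.val < 4 := by omega
    have hb : (⟨i.val, hi'⟩ : Fin 4) = q := Fin.ext hi
    rw [lowerRow, dif_pos hi', hb] at h0
    rcases eq_or_ne l q with rfl | hl
    · exact h1 (by linear_combination h0)
    · refine h.col_ne_int l hl 0 (-(m + 1)) ?_
      simp only [diff]
      push_cast
      linear_combination h0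
  · have hi' : ¬ i.val < 4 := by omega
    have ha : (⟨i.val - 4, by omega⟩ : Fin 4) = p := Fin.ext (by simp; omega)
    rw [lowerRow, dif_neg hi', ha] at h0
    rcases eq_or_ne l p with rfl | hl
    · exact h1 (by linear_combination h0)
    · refine h.row_ne_int l hl 0 (-(m + 1)) ?_
      simp only [diff]
      push_cast
      linear_combination h0

/-- The difference `y_i - y_j` divided by the Gamma values at the upper parameters of both; it has
no poles. -/
noncomputable def crossReg (i j : Fin 8) (P : Params) : ℂ :=
  yReg i P * ∏ l, (Gamma (upperRow P j l))⁻¹ - yReg j P * ∏ l, (Gamma (upperRow P i l))⁻¹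

/-- If an upper parameter is `0`, then the regularized series consists of its first term. -/
lemma yReg_ne_zero {P : Params} {i : Fin 8} {l : Fin 4} (hl : upperRow P i l = 0)
    (hlow : ∀ l' (m : ℕ), lowerRow P i l' ≠ -(m : ℂ)) : yReg i P ≠ 0 := by
  have h1 : ∀ m, m ≠ 0 → regTerm (upperRow P i) (lowerRow P i) m = 0 := fun m hm => by
    rw [regTerm, Finset.prod_eq_zero (Finset.mem_univ l), zero_mul]
    rw [hl, ascPochhammer_eval_zero, if_neg hm]
  rw [yReg, tsum_eq_single 0 h1]
  refine mul_ne_zero (by split_ifs <;> simp) ?_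
  simp only [regTerm, ascPochhammer_zero, Polynomial.eval_one, Finset.prod_const_one, one_mul,
    Nat.cast_zero, add_zero]
  exact Finset.prod_ne_zero_iff.2 fun l' _ => inv_ne_zero (Gamma_ne_zero (hlow l'))

/-- At a point where an entry that occurs in `y_i` only is isolated, `y_j` does not contribute. -/
lemma exists_crossReg_ne_zero (k : Fin 4) {i j : Fin 8} (hij : i ≠ j) :
    ∃ B, crossReg i j (family B k) ≠ 0 := by
  obtain ⟨p, q, hpq, hi, hj⟩ := exists_onLine_of_ne i j hij
  obtain ⟨B, hB⟩ := exists_isIsolated k p q hpq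
  refine ⟨B, ?_⟩
  obtain ⟨l, hl⟩ := hi.exists_upperRow_eq
  have hl0 : upperRow (family B k) i l = 0 := by
    have h1 := hB.eq_neg_one
    rw [diff] at h1
    rw [hl]
    linear_combination h1
  have h2 : ∏ l, (Gamma (upperRow (family B k) i l))⁻¹ = 0 :=
    Finset.prod_eq_zero (Finset.mem_univ l) (by rw [hl0, Gamma_zero, inv_zero])
  rw [crossReg, h2, mul_zero, sub_zero]
  refine mul_ne_zero (yReg_ne_zero hl0 (hB.lowerRow_ne hi))
    (Finset.prod_ne_zero_iff.2 fun l' _ => inv_ne_zero (Gamma_ne_zero fun m hm => ?_))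
  obtain ⟨a, b, hab, hrow⟩ := exists_upperRow_eq j l'
  refine hB.ne_int a b ?_ (-(m + 1)) ?_
  · by_contra! h
    exact hj (h.1 ▸ h.2 ▸ hab)
  · rw [hrow] at hm
    simp only [diff]
    push_cast
    linear_combination hm

/-! ### Density -/

/-- No difference `α_l - β_l'` of the `k`-th family is an integer, and neither is `A₀ + 1/2`. This
implies admissibility for all `i`, `j`. -/
def Generic (k : Fin 4) (A : Fin 4 → ℂ) : Prop :=
  (∀ l l' (m : ℤ), (family A k).up l - (family A k).beta l' ≠ m) ∧ ∀ m : ℤ, A 0 + 1 / 2 ≠ m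

lemma Generic.admissible {k : Fin 4} {A : Fin 4 → ℂ} (hA : Generic k A) (i j : Fin 8) :
    Admissible k i j A := by
  have key : ∀ (n m : ℕ) l i, upperRow ((family A k).shift n) i l ≠ -(m : ℂ) := by
    intro n m l i h
    obtain ⟨a, b, -, hab⟩ := exists_upperRow_eq i l
    rw [hab, shift_up_eq, shift_beta_eq] at h
    have hint : ∃ e : ℤ, (![1, 1, 0, 0] a - ![0, 1, 1, 0] b : ℂ) = e := by
      refine ⟨![1, 1, 0, 0] a - ![0, 1, 1, 0] b, ?_⟩
      fin_cases a <;> fin_cases b <;> simp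
    obtain ⟨e, he⟩ := hint
    refine hA.1 a b (n * e - m - 1) ?_
    push_cast
    linear_combination h + n * he
  have hpoch : ∀ (z : ℂ), (∀ m : ℕ, z ≠ -(m : ℂ)) → ∀ n, poch z n ≠ 0 := fun z hz n h =>
    Gamma_ne_zero (s := z + n) (fun m hm => hz (m + n) (by push_cast; linear_combination hm))
      (by rw [Gamma_add_nat_eq hz]; simp [show (ascPochhammer ℂ n).eval z = 0 from h])
  have h0 : ∀ m : ℕ, A 0 + 1 / 2 ≠ -(m : ℂ) := fun m h => hA.2 (-m) (by push_cast; exact h)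
  have h1 : ∀ m : ℕ, -A 0 + 1 / 2 ≠ -(m : ℂ) := fun m h => hA.2 (m + 1) (by
    push_cast; linear_combination -h)
  have h2 : ∀ m : ℕ, (1 / 2 : ℂ) ≠ -(m : ℂ) := fun m h =>
    ne_intCast_of_eq_neg_half m (by push_cast; linear_combination -h)
  refine ⟨fun n m l => ⟨key n m l i, key n m l j⟩, fun n => ?_⟩
  have hf : (n.factorial : ℂ) ≠ 0 := by exact_mod_cast n.factorial_ne_zero
  have p0 := hpoch _ h0 n
  have p1 := hpoch _ h1 n
  have p2 := hpoch _ h2 n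
  fin_cases k <;> simp only [ratioDen]
  · exact hf
  · exact mul_ne_zero (mul_ne_zero hf p1) p0
  · exact mul_ne_zero hf p2
  · exact mul_ne_zero (mul_ne_zero (mul_ne_zero hf p2) p1) p0

lemma countable_not_generic {k : Fin 4} {A v : Fin 4 → ℂ}
    (h : ∀ l l', ((family v k).up l - (family 0 k).up l)
        - ((family v k).beta l' - (family 0 k).beta l') ≠ 0 ∨
      ∀ m : ℤ, (family A k).up l - (family A k).beta l' ≠ m)
    (h0 : v 0 ≠ 0 ∨ ∀ m : ℤ, A 0 + 1 / 2 ≠ m) :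
    {z : ℂ | ¬ Generic k (A + z • v)}.Countable := by
  refine ((Set.countable_iUnion fun l => Set.countable_iUnion fun l' =>
    countable_affine_intCast (h l l')).union (countable_affine_intCast h0)).mono fun z hz => ?_
  simp only [Set.mem_ofPred_eq, Generic, not_and_or, not_forall, not_not, family_up_line,
    family_beta_line, Pi.add_apply, Pi.smul_apply, smul_eq_mul] at hz
  simp only [Set.mem_union, Set.mem_iUnion, Set.mem_ofPred_eq]
  refine hz.imp ?_ ?_
  · rintro ⟨l, l', m, hm⟩
    exact ⟨l, l', m, by linear_combination hm⟩
  · rintro ⟨m, hm⟩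
    exact ⟨m, by linear_combination hm⟩

lemma countable_not_generic_genericDir (k : Fin 4) (A : Fin 4 → ℂ) :
    {z : ℂ | ¬ Generic k (A + z • genericDir)}.Countable :=
  countable_not_generic (fun l l' => (family_sub_eq_or k l l').imp_right fun h m => by
    rw [h]; exact ne_intCast_of_eq_neg_half m) (Or.inl (by simp [genericDir]))

lemma countable_zeros_of_entire {F : ℂ → ℂ} (hF : Differentiable ℂ F) {w : ℂ} (hw : F w ≠ 0) :
    {z | F z = 0}.Countable := by
  refine (HereditarilyLindelofSpace.isLindelof _).countable (discreteTopology_subtype_iff.2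
    fun x _ => ?_)
  rw [← disjoint_iff, disjoint_principal_right]
  have han : AnalyticOnNhd ℂ F Set.univ := hF.differentiableOn.analyticOnNhd isOpen_univ
  by_contra h
  exact hw (han.eqOn_zero_of_preconnected_of_frequently_eq_zero isPreconnected_univ
    (Set.mem_univ x) (fun h' => h (by filter_upwards [h'] with z hz using hz)) (Set.mem_univ w))

lemma shift_zero_family (A : Fin 4 → ℂ) (k : Fin 4) : (family A k).shift 0 = family A k := by
  fin_cases k <;> simp [family, Params.shift]

lemma differentiable_crossReg_line (A v : Fin 4 → ℂ) (k : Fin 4) (i j : Fin 8) :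
    Differentiable ℂ fun z : ℂ => crossReg i j (family (A + z • v) k) := by
  have hy := fun i => differentiable_yReg_line A v k 0 i
  have hG := fun i l => differentiable_one_div_Gamma.comp (differentiable_upperRow_line A v k 0 i l)
  simp only [shift_zero_family] at hy hG
  exact ((hy i).mul (Differentiable.fun_finsetProd fun l _ => hG j l)).sub
    ((hy j).mul (Differentiable.fun_finsetProd fun l _ => hG i l))

/-- At `n = 0` the Pochhammer ratio is `1`. -/
lemma Admissible.W_zero_eq {A : Fin 4 → ℂ} {k : Fin 4} {i j : Fin 8} (hA : Admissible k i j A) :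
    W k i j 0 A = (∏ l, Gamma (upperRow (family A k) i l)) *
      (∏ l, Gamma (upperRow (family A k) j l)) * crossReg i j (family A k) := by
  have hi : ∀ l (m : ℕ), upperRow (family A k) i l ≠ -(m : ℂ) := fun l m => by
    simpa only [shift_zero_family] using (hA.1 0 m l).1
  have hj : ∀ l (m : ℕ), upperRow (family A k) j l ≠ -(m : ℂ) := fun l m => by
    simpa only [shift_zero_family] using (hA.1 0 m l).2
  have hr : ratioNum A 0 k / ratioDen A 0 k = 1 := by
    fin_cases k <;> simp [ratioNum, ratioDen, poch]
  have hGi : ∏ l, Gamma (upperRow (family A k) i l) ≠ 0 :=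
    Finset.prod_ne_zero_iff.2 fun l _ => Gamma_ne_zero (hi l)
  have hGj : ∏ l, Gamma (upperRow (family A k) j l) ≠ 0 :=
    Finset.prod_ne_zero_iff.2 fun l _ => Gamma_ne_zero (hj l)
  rw [W, hr, shift_zero_family, y_eq_prod_Gamma_mul_yReg hi, y_eq_prod_Gamma_mul_yReg hj,
    crossReg, Finset.prod_inv_distrib, Finset.prod_inv_distrib]
  field_simp

/-- Near a given point there is a generic one, and on the line from there to a point where
`crossReg` does not vanish all but countably many points are good. -/
theorem dense_admissible_W_ne_zero (k : Fin 4) {i j : Fin 8} (hij : i ≠ j) :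
    Dense {A : Fin 4 → ℂ | Admissible k i j A ∧ W k i j 0 A ≠ 0} := by
  obtain ⟨B, hB⟩ := exists_crossReg_ne_zero k hij
  -- A nonempty open set meets the complement of a countable set of parameters on each line.
  have line : ∀ (A v : Fin 4 → ℂ) (V : Set (Fin 4 → ℂ)), IsOpen V → A ∈ V → ∀ T : Set ℂ,
      T.Countable → ∃ z ∉ T, A + z • v ∈ V := by
    intro A v V hV hA T hT
    have hc : Continuous fun z : ℂ => A + z • v := by fun_prop
    obtain ⟨z, hz, hzT⟩ := (hT.dense_compl ℂ).inter_open_nonempty _ (hV.preimage hc)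
      ⟨0, by simpa using hA⟩
    exact ⟨z, hzT, hz⟩
  rw [dense_iff_inter_open]
  rintro V hV ⟨A₀, hA₀⟩
  obtain ⟨z₀, hz₀, hA₁⟩ := line A₀ genericDir V hV hA₀ _ (countable_not_generic_genericDir k A₀)
  simp only [Set.mem_ofPred_eq, not_not] at hz₀
  generalize A₀ + z₀ • genericDir = A₁ at hz₀ hA₁
  obtain ⟨v, hv⟩ : ∃ v, v = B - A₁ := ⟨_, rfl⟩
  have hF := differentiable_crossReg_line A₁ v k i j
  have hzero : {z : ℂ | crossReg i j (family (A₁ + z • v) k) = 0}.Countable :=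
    countable_zeros_of_entire hF (w := 1) (by simpa [hv] using hB)
  obtain ⟨z, hz, hzV⟩ := line A₁ v V hV hA₁ _ ((countable_not_generic (k := k) (A := A₁) (v := v)
    (fun l l' => Or.inr (hz₀.1 l l')) (Or.inr hz₀.2)).union hzero)
  simp only [Set.mem_union, Set.mem_ofPred_eq, not_or, not_not] at hz
  have hadm := hz.1.admissible i j
  refine ⟨_, hzV, hadm, ?_⟩
  rw [hadm.W_zero_eq]
  exact mul_ne_zero (mul_ne_zero
    (Finset.prod_ne_zero_iff.2 fun l _ => Gamma_ne_zero fun m => by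
      simpa only [shift_zero_family] using (hadm.1 0 m l).1)
    (Finset.prod_ne_zero_iff.2 fun l _ => Gamma_ne_zero fun m => by
      simpa only [shift_zero_family] using (hadm.1 0 m l).2)) hz.2

end ZEq

theorem mainTheorem12 (k : Fin 4) (i j : Fin 8) (hij : i ≠ j) :
    (∀ A : Fin 4 → ℂ, ZEq.Admissible k i j A →
      -- the series that define the values `y_i`, `y_j` converge
      (∀ (n : ℕ), ∀ s ∈ ({i, j} : Set (Fin 8)),
        Summable (ZEq.term (ZEq.upperRow ((ZEq.family A k).shift n) s)
          (ZEq.lowerRow ((ZEq.family A k).shift n) s))) ∧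
      -- the power series converges on the unit disc, with constant term `W_{k,ij}(0; A)`
      (∀ x ∈ Metric.ball (0 : ℂ) 1, Summable fun n : ℕ => ZEq.W k i j n A * x ^ n) ∧
      DifferentiableOn ℂ (ZEq.S k i j A) (Metric.ball 0 1) ∧
      ZEq.S k i j A 0 = ZEq.W k i j 0 A ∧
      -- every branch of `x^{A₀ - 1/2} ∑ W_{k,ij}(n; A) xⁿ` solves `Z(A)`
      (∀ (U : Set ℂ) (L : ℂ → ℂ), IsOpen U → U ⊆ Metric.ball 0 1 \ {0} →
        DifferentiableOn ℂ L U → (∀ x ∈ U, Complex.exp (L x) = x) →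
        ZEq.Solves A U (ZEq.f k i j A L))) ∧
    -- generically the leading coefficient is nonzero, so that the exponent is `A₀ - 1/2`
    Dense {A : Fin 4 → ℂ | ZEq.Admissible k i j A ∧ ZEq.W k i j 0 A ≠ 0} := by
  refine ⟨fun A hA => ?_, ZEq.dense_admissible_W_ne_zero k hij⟩
  have hrec := hA.W_recurrence
  have hw : ZEq.Subexp fun n => ZEq.W k i j n A := ZEq.subexp_of_Pm_recurrence hrec
  refine ⟨fun n s hs => ZEq.summable_term (fun l m => ?_) (ZEq.family_rows_balanced A k n s),
    fun x hx => hw.summable hx, hw.differentiableOn, ?_, fun U L hU hU1 hL hexp =>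
      ZEq.solves_of_recurrence hw hrec hU hU1 hL hexp⟩
  · rcases hs with rfl | rfl
    · exact (hA.1 n m l).1
    · exact (hA.1 n m l).2
  · rw [ZEq.S, tsum_eq_single 0 fun n hn => by simp [hn]]
    simp
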